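/- Let $w:(0,\infty)\to(0,\infty)$ be a measurable weight with $1/w$ locally integrable on $(0,\infty)$ (for instance, $w$ continuous), and let $L^2=L^2((0,\infty),w(r)\,dr)$ be the space of complex-valued square integrable functions, with norm $\|\cdot\|_2$ and inner product $\langle f,g\rangle=\int_0^\infty f\,\overline g\,w\,dr$. Let $P=\sum_{i=0}^n a_i(r)\,\frac{d^i}{dr^i}$, $n\ge 1$, be an elliptic differential operator on $(0,\infty)$, i.e. the coefficients $a_i$ are continuous and $a_n(r)\neq 0$ for all $r>0$. Let $(\psi_k)_{k\ge 0}$ be an orthogonal basis of $L^2$ consisting of functions of class $C^n$ on $(0,\infty)$ with $P\psi_k=\lambda_k\psi_k$ on $(0,\infty)$, and put $c_k^{-1}=\int_0^\infty|\psi_k|^2\,w\,dr$. Assume that (i) $\psi_k(0)=1$, in the sense that $\lim_{r\to 0^+}\psi_k(r)=1$, for every $k$; (ii) $\lambda_k\ge 0$ for every $k$; (iii) $\lambda_k$ and $c_k$ grow polynomially, in the sense that there are $A,\alpha>0$ and $C,\beta\in\mathbb R$ with $\lambda_k\ge A k^{\alpha}$ and $c_k\le C k^{\beta}$ for all sufficiently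 large $k$. For $f,g\in L^2$ write $Pf=g$ if $\langle g,\psi_k\rangle=\langle f,P\psi_k\rangle$ for all $k$; this is the self-adjoint operator on $L^2$ obtained as the closure of the differential operator $P$ on the linear span of the $\psi_k$, and $\|P^mf\|_2^2=\sum_k\lambda_k^{2m}c_k|\langle f,\psi_k\rangle|^2$. Let $f\in L^2$ be such that $P^mf\in L^2$ for all $m\in\mathbb N$ (that is, $f$ lies in the domain of every power $P^m$) and $$\sum_{m=1}^\infty\|P^mf\|_2^{-1/(2m)}=\infty,$$ where a term with $P^mf=0$ counts as $\infty$. If $f$ vanishes (almost everywhere) on some interval $(0,\delta)$, $\delta>0$, then $f=0$ (almost everywhere) on $(0,\infty)$. -/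

import Mathlib

open Set Filter Topology MeasureTheory
open scoped ComplexConjugate

noncomputable section

namespace EigenExpansion

/-- The measure `w(r) dr` on `ℝ⁺ = (0, ∞)`, regarded as a measure on `ℝ`. -/
def weightMeasure (w : ℝ → ℝ) : Measure ℝ :=
  (volume.restrict (Ioi (0 : ℝ))).withDensity fun r => ENNReal.ofReal (w r)

/-- The ordinary differential operator `u ↦ ∑_{i ≤ n} a_i u^{(i)}`. -/
def diffOp (n : ℕ) (a : ℕ → ℝ → ℂ) (u : ℝ → ℂ) (r : ℝ) : ℂ :=
  ∑ i ∈ Finset.range (n + 1), a i r * iteratedDeriv i u r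

/-- `∑_{i ≤ n} a_i (d/dr)^i` is an elliptic differential operator of order `n ≥ 1` on `(0, ∞)`:
its coefficients are continuous there and the leading one has no zero. -/
structure IsElliptic (n : ℕ) (a : ℕ → ℝ → ℂ) : Prop where
  order_pos : 0 < n
  continuousOn_coeff : ∀ i ≤ n, ContinuousOn (a i) (Ioi 0)
  leading_ne_zero : ∀ r > 0, a n r ≠ 0

/-- The sequence `ψ` is an orthogonal basis of the complex Hilbert space `L²(μ)`. -/
structure IsOrthogonalBasis (μ : Measure ℝ) (ψ : ℕ → ℝ → ℂ) : Prop where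
  memLp : ∀ k, MemLp (ψ k) 2 μ
  ne_zero : ∀ k, ¬ ψ k =ᵐ[μ] 0
  orthogonal : ∀ j k, j ≠ k → ∫ r, conj (ψ j r) * ψ k r ∂μ = 0
  dense_span :
    (Submodule.span ℂ (range fun k => (memLp k).toLp (ψ k))).topologicalClosure = ⊤

/-- `c_k`, given by `c_k⁻¹ = ∫ |ψ_k|² dμ`. -/
def normConst (μ : Measure ℝ) (ψ : ℕ → ℝ → ℂ) (k : ℕ) : ℝ :=
  (∫ r, ‖ψ k r‖ ^ 2 ∂μ)⁻¹

/-- `g = P f` in `L²(μ)`, where `P` is the `L²`-realization, determined by the basis `ψ`, of the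
differential operator with coefficients `a`: `f` and `g` are in `L²(μ)` and
`⟨g, ψ_k⟩ = ⟨f, P ψ_k⟩` for every `k`. (This is the Hilbert space adjoint of the differential
operator with domain `span {ψ_k}`; if the `ψ_k` are an orthogonal basis of eigenfunctions with real
eigenvalues it is self-adjoint and is also the closure of that operator.) -/
def IsImage (μ : Measure ℝ) (n : ℕ) (a : ℕ → ℝ → ℂ) (ψ : ℕ → ℝ → ℂ) (f g : ℝ → ℂ) : Prop :=
  MemLp f 2 μ ∧ MemLp g 2 μ ∧
    ∀ k, ∫ r, conj (ψ k r) * g r ∂μ = ∫ r, conj (diffOp n a (ψ k) r) * f r ∂μ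

end EigenExpansion

end

/-! The functions $P^mf$ all vanish on $(0,\delta)$, because the $L^2$-realization of $P$ is local:
if partial sums of the expansion of $f$ tend to $f$ and their images tend to $Pf$, the interior
estimate for $P$ forces $Pf=0$ wherever $f=0$ (`IsImage.ae_eq_zero`).

Fix an eigenvalue $\lambda$, let $U$ be the component of $f$ in its finite-dimensional eigenspace,
and let $\varphi=U\cdot 1_{(0,\delta)}$. Then $\langle\varphi,P^mf\rangle=0$ for every $m$. By
Parseval this says that the complex measure with masses $\langle\varphi,b_k\rangle\langle
b_k,f\rangle$ at the points $\sqrt{\lambda_k}$, with $(b_k)$ the normalized basis, has vanishing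
even moments, while its absolute moments of order $2m$ are at most a constant times $\|P^mf\|$.

The cosine transform of this measure is therefore flat at $0$. The Carleman condition makes it
quasi-analytic (Carleman's inequality and Bang's proof of Denjoy–Carleman,
`eq_zero_of_flat_of_not_summable`), hence zero, and taking means against cosines shows that the
masses at each point sum to zero (`tsum_fiber_eq_zero_of_moments`). At $\sqrt\lambda$ this reads
$\int_0^\delta|U|^2w\,dr=0$. Since $PU=\lambda U$, unique continuation
(`IsElliptic.eq_zero_of_vanishing`) gives $U=0$. Every spectral component of $f$ vanishes, so $f=0$.
-/

namespace EigenExpansion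

/-! ### Carleman's inequality -/

/-- AM–GM for the numbers $(i+1)a_i$, together with $(n+1)!^{1/(n+1)}\ge(n+1)/e$. The factor 2 pays
for replacing $(n+1)^2$ by $(n+1)(n+2)$, whose reciprocals telescope when summed. -/
theorem prod_rpow_le_weighted_sum (a : ℕ → ℝ) (ha : ∀ i, 0 ≤ a i) (n : ℕ) :
    (∏ i ∈ Finset.range (n + 1), a i) ^ ((1 : ℝ) / (n + 1)) ≤
      2 * Real.exp 1 * ((∑ i ∈ Finset.range (n + 1), ((i : ℝ) + 1) * a i) /
        (((n : ℝ) + 1) * (n + 2))) := by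
  have hn : (0 : ℝ) < n + 1 := by positivity
  set S := ∑ i ∈ Finset.range (n + 1), ((i : ℝ) + 1) * a i with hS
  have hS0 : 0 ≤ S := Finset.sum_nonneg fun i _ => mul_nonneg (by positivity) (ha i)
  have hP0 : 0 ≤ ∏ i ∈ Finset.range (n + 1), a i := Finset.prod_nonneg fun i _ => ha i
  have amgm := Real.geom_mean_le_arith_mean (Finset.range (n + 1)) (fun _ => (1 : ℝ))
    (fun i => ((i : ℝ) + 1) * a i) (fun _ _ => zero_le_one) (by simpa using hn)
    (fun i _ => mul_nonneg (by positivity) (ha i))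
  have hfact : ∏ i ∈ Finset.range (n + 1), ((i : ℝ) + 1) = ((n + 1).factorial : ℝ) := by
    rw [← Finset.prod_range_add_one_eq_factorial]; push_cast; rfl
  simp only [Real.rpow_one, one_mul, Finset.sum_const, Finset.card_range, nsmul_eq_mul, mul_one,
    Finset.prod_mul_distrib, hfact, Nat.cast_add, Nat.cast_one, ← hS] at amgm
  rw [Real.mul_rpow (by positivity) hP0] at amgm
  have hfac : ((n : ℝ) + 1) / Real.exp 1 ≤ (((n + 1).factorial : ℝ)) ^ ((n : ℝ) + 1)⁻¹ := by
    rw [Real.le_rpow_inv_iff_of_pos (by positivity) (by positivity) hn]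
    have h := Real.pow_div_factorial_le_exp _ hn.le (n + 1)
    have e1 : (((n : ℝ) + 1) / Real.exp 1) ^ ((n : ℝ) + 1) =
        ((n : ℝ) + 1) ^ (n + 1) / Real.exp ((n : ℝ) + 1) := by
      rw [show ((n : ℝ) + 1) = ((n + 1 : ℕ) : ℝ) by push_cast; rfl, Real.rpow_natCast, div_pow,
        ← Real.exp_nat_mul, mul_one]
    rw [e1, div_le_iff₀ (Real.exp_pos _)]
    rw [div_le_iff₀ (by positivity)] at h
    linarith
  set X := (∏ i ∈ Finset.range (n + 1), a i) ^ ((n : ℝ) + 1)⁻¹ with hX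
  have hX0 : 0 ≤ X := Real.rpow_nonneg hP0 _
  have h1 : ((n : ℝ) + 1) / Real.exp 1 * X ≤ S / (n + 1) :=
    (mul_le_mul_of_nonneg_right hfac hX0).trans amgm
  rw [one_div, ← hX]
  have h2 : X ≤ Real.exp 1 * (S / ((n + 1) * (n + 1))) := by
    rw [div_mul_eq_mul_div, div_le_iff₀ (Real.exp_pos _)] at h1
    calc X = ((n : ℝ) + 1) * X / (n + 1) := by field_simp
      _ ≤ S / (n + 1) * Real.exp 1 / (n + 1) := by gcongr
      _ = _ := by field_simp
  refine h2.trans ?_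
  have h3 : S / (((n : ℝ) + 1) * (n + 1)) ≤ 2 * (S / ((n + 1) * (n + 2))) := by
    rw [← mul_div_assoc, div_le_div_iff₀ (by positivity) (by positivity)]
    have : 0 ≤ S * (n + 1) * n := by positivity
    nlinarith
  calc _ ≤ Real.exp 1 * (2 * (S / ((n + 1) * (n + 2)))) := by gcongr
    _ = _ := by ring

/-- Carleman's inequality (with the constant `2e`) for finite sums. -/
theorem carleman_inequality (a : ℕ → ℝ) (ha : ∀ i, 0 ≤ a i) (N : ℕ) :
    ∑ n ∈ Finset.range N, (∏ i ∈ Finset.range (n + 1), a i) ^ ((1 : ℝ) / (n + 1)) ≤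
      2 * Real.exp 1 * ∑ i ∈ Finset.range N, a i := by
  -- Summation by parts with $\frac1{(n+1)(n+2)}=\frac1{n+1}-\frac1{n+2}$; the subtracted boundary
  -- term is nonnegative and is dropped at the end.
  have key : ∀ N : ℕ, ∑ n ∈ Finset.range N,
      (∑ i ∈ Finset.range (n + 1), ((i : ℝ) + 1) * a i) / (((n : ℝ) + 1) * (n + 2)) =
      ∑ i ∈ Finset.range N, a i - (∑ i ∈ Finset.range N, ((i : ℝ) + 1) * a i) / (N + 1) := by
    intro N
    induction N with
    | zero => simp
    | succ N ih =>
      rw [Finset.sum_range_succ, ih, Finset.sum_range_succ _ N, Finset.sum_range_succ _ N]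
      push_cast
      have h1 : (N : ℝ) + 1 ≠ 0 := by positivity
      have h2 : (N : ℝ) + 2 ≠ 0 := by positivity
      have h3 : (N : ℝ) + 1 + 1 ≠ 0 := by positivity
      field_simp
      ring
  calc _ ≤ ∑ n ∈ Finset.range N, 2 * Real.exp 1 *
        ((∑ i ∈ Finset.range (n + 1), ((i : ℝ) + 1) * a i) / (((n : ℝ) + 1) * (n + 2))) :=
        Finset.sum_le_sum fun n _ => prod_rpow_le_weighted_sum a ha n
    _ = 2 * Real.exp 1 * (∑ i ∈ Finset.range N, a i -
        (∑ i ∈ Finset.range N, ((i : ℝ) + 1) * a i) / (N + 1)) := by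
      rw [← Finset.mul_sum, key]
    _ ≤ _ := by
      gcongr
      have : 0 ≤ (∑ i ∈ Finset.range N, ((i : ℝ) + 1) * a i) / (N + 1) :=
        div_nonneg (Finset.sum_nonneg fun i _ => mul_nonneg (by positivity) (ha i)) (by positivity)
      linarith

/-- If `M n / M (n + 1)` is summable then so is `(M 0 / M (n + 1)) ^ (1 / (n + 1))`. -/
theorem summable_rpow_of_summable_ratio (M : ℕ → ℝ) (hM : ∀ n, 0 < M n)
    (hs : Summable fun n => M n / M (n + 1)) :
    Summable fun n : ℕ => (M 0 / M (n + 1)) ^ ((1 : ℝ) / (n + 1)) := by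
  -- The ratios telescope, so the terms in question are their geometric means and Carleman's
  -- inequality applies.
  have hprod : ∀ n, ∏ i ∈ Finset.range (n + 1), (M i / M (i + 1)) = M 0 / M (n + 1) := by
    intro n
    induction n with
    | zero => simp
    | succ n ih =>
      rw [Finset.prod_range_succ, ih]
      have := hM (n + 1)
      field_simp
  refine summable_of_sum_range_le (c := 2 * Real.exp 1 * ∑' i, M i / M (i + 1))
    (fun n => Real.rpow_nonneg (div_nonneg (hM _).le (hM _).le) _) fun N => ?_
  simp_rw [← hprod]
  refine (carleman_inequality _ (fun i => div_nonneg (hM _).le (hM _).le) N).trans ?_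
  gcongr
  exact hs.sum_le_tsum _ fun i _ => div_nonneg (hM _).le (hM _).le

/-! ### Quasi-analyticity -/

section Bang

variable {E : Type*} [NormedAddCommGroup E] [NormedSpace ℝ E] {u : ℕ → ℝ → E} {M : ℕ → ℝ}

/-- Taylor's formula in norm form. The derivative in $h$ of the bound of order $J+1$ for `u n` is
the bound of order $J$ for `u (n + 1)`, so the mean value inequality drives an induction on $J$ for
all $n$ at once. -/
theorem norm_le_taylor_bound (hu : ∀ n t, HasDerivAt (u n) (u (n + 1) t) t)
    (hM : ∀ n t, ‖u n t‖ ≤ M n) (x : ℝ) (J : ℕ) :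
    ∀ n, ∀ h ≥ 0, ‖u n (x + h)‖ ≤
      ∑ j ∈ Finset.range J, ‖u (n + j) x‖ * (h ^ j / j.factorial) +
        M (n + J) * (h ^ J / J.factorial) := by
  induction J with
  | zero => intro n h _; simpa using hM n (x + h)
  | succ J ih =>
    intro n h hh
    have hpow : ∀ (j : ℕ) (y : ℝ), HasDerivAt (fun y : ℝ => y ^ (j + 1) / (j + 1).factorial)
        (y ^ j / j.factorial) y := by
      intro j y
      have h1 := (hasDerivAt_pow (j + 1) y).div_const ((j + 1).factorial : ℝ)
      refine h1.congr_deriv ?_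
      have : ((j.factorial : ℕ) : ℝ) ≠ 0 := by positivity
      rw [Nat.factorial_succ]; push_cast; field_simp
    refine image_norm_le_of_norm_deriv_right_le_deriv_boundary (a := 0) (b := h)
      (f := fun y => u n (x + y)) (f' := fun y => u (n + 1) (x + y))
      (B := fun y => ∑ j ∈ Finset.range (J + 1), ‖u (n + j) x‖ * (y ^ j / j.factorial) +
        M (n + (J + 1)) * (y ^ (J + 1) / (J + 1).factorial))
      (B' := fun y => ∑ j ∈ Finset.range J, ‖u (n + 1 + j) x‖ * (y ^ j / j.factorial) +
        M (n + 1 + J) * (y ^ J / J.factorial)) ?_ ?_ ?_ ?_ ?_ ⟨hh, le_rfl⟩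
    · intro y _
      exact ((hu n (x + y)).comp_const_add x y).continuousAt.continuousWithinAt
    · intro y _
      exact ((hu n (x + y)).comp_const_add x y).hasDerivWithinAt
    · simp [Finset.sum_range_succ']
    · intro y
      refine HasDerivAt.add ?_ ?_
      · simp_rw [Finset.sum_range_succ']
        simp only [pow_zero, Nat.factorial_zero, Nat.cast_one, div_one, mul_one, add_zero]
        refine HasDerivAt.add_const _ ?_
        refine HasDerivAt.fun_sum fun j _ => ?_
        rw [show n + 1 + j = n + (j + 1) by ring]
        exact (hpow j y).const_mul _
      · rw [show n + 1 + J = n + (J + 1) by ring]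
        exact (hpow J y).const_mul _
    · intro y hy
      exact ih (n + 1) y hy.1

/-- One step of Bang's method: a move of length at most $M_N/(eM_{N+1})$ costs one level.
Log-convexity gives $M_{n+j}(eh)^j\le M_n$, so the Taylor terms are at most $e^{n-N-1}M_n/j!$ and
their sum gains a factor at most $e$. -/
theorem bang_step (hu : ∀ n t, HasDerivAt (u n) (u (n + 1) t) t)
    (hM : ∀ n t, ‖u n t‖ ≤ M n) (hpos : ∀ n, 0 < M n)
    (hconv : ∀ n, M (n + 1) ^ 2 ≤ M n * M (n + 2)) (N : ℕ) (x h : ℝ) (hh : 0 ≤ h)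
    (hh' : h ≤ M N / (Real.exp 1 * M (N + 1)))
    (hx : ∀ n ≤ N + 1, ‖u n x‖ ≤ Real.exp ((n : ℝ) - (N + 1 : ℕ)) * M n) :
    ∀ n ≤ N, ‖u n (x + h)‖ ≤ Real.exp ((n : ℝ) - N) * M n := by
  intro n hn
  have hmono : Monotone fun i => M (i + 1) / M i := by
    refine monotone_nat_of_le_succ fun i => ?_
    rw [div_le_div_iff₀ (hpos _) (hpos _)]
    nlinarith [hconv i]
  have hstep : ∀ i ≤ N, M (i + 1) * (Real.exp 1 * h) ≤ M i := by
    intro i hi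
    have h1 : M (i + 1) / M i ≤ M (N + 1) / M N := hmono hi
    have h2 : M (i + 1) ≤ M (N + 1) / M N * M i := (div_le_iff₀ (hpos _)).1 h1
    have h3 : Real.exp 1 * h ≤ M N / M (N + 1) := by
      calc Real.exp 1 * h ≤ Real.exp 1 * (M N / (Real.exp 1 * M (N + 1))) := by gcongr
        _ = _ := by have := hpos (N + 1); field_simp
    calc M (i + 1) * (Real.exp 1 * h) ≤ (M (N + 1) / M N * M i) * (M N / M (N + 1)) := by
          have := hpos (N + 1); have := hpos N; have := hpos i
          gcongr
      _ = M i := by have := hpos (N + 1); have := hpos N; field_simp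
  have hdec : ∀ j, n + j ≤ N + 1 → M (n + j) * (Real.exp 1 * h) ^ j ≤ M n := by
    intro j
    induction j with
    | zero => intro _; simp
    | succ j ih =>
      intro hj
      calc M (n + (j + 1)) * (Real.exp 1 * h) ^ (j + 1)
          = (M (n + j + 1) * (Real.exp 1 * h)) * (Real.exp 1 * h) ^ j := by
            rw [pow_succ, ← add_assoc]; ring
        _ ≤ M (n + j) * (Real.exp 1 * h) ^ j := by
            gcongr; exact hstep _ (by omega)
        _ ≤ M n := ih (by omega)
  -- With this order the remainder involves $M_{N+1}$, where the exponential weight is $e^0=1$; it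
  -- has the same form as the other terms.
  obtain ⟨J, hJ⟩ : ∃ J, n + J = N + 1 := ⟨N + 1 - n, by omega⟩
  have hterm : ∀ j ≤ J, Real.exp (((n + j : ℕ) : ℝ) - (N + 1 : ℕ)) * M (n + j) *
      (h ^ j / j.factorial) ≤ Real.exp ((n : ℝ) - (N + 1 : ℕ)) * M n * (1 ^ j / j.factorial) := by
    intro j hj
    have e1 : Real.exp (((n + j : ℕ) : ℝ) - (N + 1 : ℕ)) =
        Real.exp ((n : ℝ) - (N + 1 : ℕ)) * Real.exp 1 ^ j := by
      rw [← Real.exp_nat_mul, ← Real.exp_add]; congr 1; push_cast; ring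
    calc _ = Real.exp ((n : ℝ) - (N + 1 : ℕ)) * (M (n + j) * (Real.exp 1 * h) ^ j) /
          j.factorial := by rw [e1, mul_pow]; ring
      _ ≤ Real.exp ((n : ℝ) - (N + 1 : ℕ)) * M n / j.factorial := by
          gcongr; exact hdec j (by omega)
      _ = _ := by simp [div_eq_mul_inv]
  calc ‖u n (x + h)‖ ≤ _ := norm_le_taylor_bound hu hM x J n h hh
    _ ≤ ∑ j ∈ Finset.range (J + 1),
        Real.exp ((n : ℝ) - (N + 1 : ℕ)) * M n * (1 ^ j / j.factorial) := by
      rw [Finset.sum_range_succ]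
      refine add_le_add (Finset.sum_le_sum fun j hj => ?_) ?_
      · have hj' := Finset.mem_range.1 hj
        refine le_trans ?_ (hterm j hj'.le)
        gcongr
        exact hx _ (by omega)
      · refine le_trans (le_of_eq ?_) (hterm J le_rfl)
        rw [hJ]; simp
    _ = Real.exp ((n : ℝ) - (N + 1 : ℕ)) * M n *
        ∑ j ∈ Finset.range (J + 1), (1 : ℝ) ^ j / j.factorial := by rw [Finset.mul_sum]
    _ ≤ Real.exp ((n : ℝ) - (N + 1 : ℕ)) * M n * Real.exp 1 := by
      have := hpos n
      gcongr
      exact Real.sum_le_exp_of_nonneg zero_le_one _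
    _ = _ := by
      rw [mul_right_comm, ← Real.exp_add]; congr 2; push_cast; ring

/-- The Denjoy–Carleman theorem on `[0, ∞)`: a function whose derivatives are bounded by a
log-convex sequence `M` with `∑ M n / M (n + 1) = ∞` and all vanish at `0` is zero. -/
theorem eq_zero_of_flat_of_not_summable (hu : ∀ n t, HasDerivAt (u n) (u (n + 1) t) t)
    (hM : ∀ n t, ‖u n t‖ ≤ M n) (hpos : ∀ n, 0 < M n)
    (hconv : ∀ n, M (n + 1) ^ 2 ≤ M n * M (n + 2))
    (hdiv : ¬ Summable fun n => M n / M (n + 1)) (hflat : ∀ n, u n 0 = 0) (x : ℝ) (hx : 0 ≤ x) :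
    u 0 x = 0 := by
  -- Flatness gives every level at $0$; $m$ Bang steps then descend from level $K+m$ to level $K$.
  have claim : ∀ m K : ℕ, ∀ y, 0 ≤ y →
      y ≤ ∑ i ∈ Finset.range m, M (K + i) / (Real.exp 1 * M (K + i + 1)) →
      ∀ n ≤ K, ‖u n y‖ ≤ Real.exp ((n : ℝ) - K) * M n := by
    intro m
    induction m with
    | zero =>
      intro K y hy0 hy n _
      have : y = 0 := le_antisymm (by simpa using hy) hy0
      rw [this, hflat]
      simpa using mul_nonneg (Real.exp_pos _).le (hpos n).le
    | succ m ih =>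
      intro K y hy0 hy
      rw [Finset.sum_range_succ'] at hy
      simp only [add_zero] at hy
      set d := M K / (Real.exp 1 * M (K + 1)) with hd
      have hd0 : 0 ≤ d := by have := hpos K; have := hpos (K + 1); positivity
      -- The last step has length `min y d`; the earlier ones reach `max (y - d) 0`.
      have e : y = max (y - d) 0 + min y d := by
        rcases le_total y d with h | h
        · rw [max_eq_right (by linarith), min_eq_left h]; ring
        · rw [max_eq_left (by linarith), min_eq_right h]; ring
      rw [e]
      refine bang_step hu hM hpos hconv K _ _ (le_min hy0 hd0) (min_le_right _ _) ?_
      refine ih (K + 1) _ (le_max_right _ _) (max_le ?_ ?_)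
      · simp_rw [show ∀ i, K + 1 + i = K + (i + 1) from fun i => by ring]
        linarith
      · refine Finset.sum_nonneg fun i _ => ?_
        have := hpos (K + 1 + i); have := hpos (K + 1 + i + 1); positivity
  -- The step lengths beyond any level $K$ still have infinite sum, so $x$ is reached with $K$
  -- levels left.
  have hK : ∀ K : ℕ, ‖u 0 x‖ ≤ Real.exp (-(K : ℝ)) * M 0 := by
    intro K
    have hns : ¬ Summable fun i => M (K + i) / (Real.exp 1 * M (K + i + 1)) := by
      intro hs
      apply hdiv
      rw [← summable_nat_add_iff K]
      refine (hs.mul_left (Real.exp 1)).congr fun i => ?_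
      have := hpos (K + i + 1)
      rw [show i + K = K + i by ring]
      field_simp
    have hnn : ∀ i, 0 ≤ M (K + i) / (Real.exp 1 * M (K + i + 1)) := fun i => by
      have := hpos (K + i + 1); have := hpos (K + i); positivity
    have ht := (not_summable_iff_tendsto_nat_atTop_of_nonneg hnn).1 hns
    obtain ⟨m, hm⟩ := (ht.eventually_ge_atTop x).exists
    simpa using claim m K x hx hm 0 (Nat.zero_le _)
  have hlim : Tendsto (fun K : ℕ => Real.exp (-(K : ℝ)) * M 0) atTop (𝓝 (0 * M 0)) :=
    ((Real.tendsto_exp_neg_atTop_nhds_zero.comp tendsto_natCast_atTop_atTop)).mul_const _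
  rw [zero_mul] at hlim
  exact norm_le_zero_iff.1 (ge_of_tendsto' hlim hK)

end Bang

/-! ### Determinacy of discrete moment sequences -/

theorem tendsto_mean_cos (c : ℝ) :
    Tendsto (fun T : ℝ => T⁻¹ * ∫ t in (0 : ℝ)..T, Real.cos (c * t)) atTop
      (𝓝 (if c = 0 then 1 else 0)) := by
  split_ifs with hc
  · refine tendsto_const_nhds.congr' ?_
    filter_upwards [eventually_gt_atTop 0] with T hT
    simp [hc, hT.ne']
  · have hi : ∀ T : ℝ, ∫ t in (0 : ℝ)..T, Real.cos (c * t) = c⁻¹ * Real.sin (c * T) := by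
      intro T
      rw [intervalIntegral.integral_comp_mul_left (fun t => Real.cos t) hc]
      simp
    simp_rw [hi]
    refine squeeze_zero_norm (a := fun T : ℝ => |c⁻¹| * |T⁻¹|) (fun T => ?_) ?_
    · rw [Real.norm_eq_abs, abs_mul, abs_mul]
      have := Real.abs_sin_le_one (c * T)
      calc _ ≤ |T⁻¹| * (|c⁻¹| * 1) := by gcongr
        _ = _ := by ring
    · have := (tendsto_inv_atTop_zero (𝕜 := ℝ)).abs.const_mul |c⁻¹|
      simpa using this

/-- Orthogonality of frequencies in the mean: the limit is $1/2$ if $s=\sigma>0$ and $1$ if both are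
$0$. Nonnegativity rules out $s=-\sigma\ne0$. -/
theorem tendsto_mean_cos_mul_cos {s σ : ℝ} (hs : 0 ≤ s) (hσ : 0 ≤ σ) :
    Tendsto (fun T : ℝ => T⁻¹ * ∫ t in (0 : ℝ)..T, Real.cos (s * t) * Real.cos (σ * t)) atTop
      (𝓝 ((if s = σ then 1 else 0) * ((1 + if σ = 0 then 1 else 0) / 2))) := by
  have h := ((tendsto_mean_cos (s - σ)).add (tendsto_mean_cos (s + σ))).div_const 2
  have e : (if s = σ then (1 : ℝ) else 0) * ((1 + if σ = 0 then 1 else 0) / 2) =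
      ((if s - σ = 0 then 1 else 0) + if s + σ = 0 then 1 else 0) / 2 := by
    by_cases h1 : s = σ
    · subst h1
      have : s + s = 0 ↔ s = 0 := by constructor <;> intro h <;> linarith
      simp [this]
    · have h2 : s - σ ≠ 0 := sub_ne_zero.2 h1
      have h3 : s + σ ≠ 0 := fun h => h1 (by linarith)
      simp [h1, h2, h3]
  rw [e]
  refine h.congr fun T => ?_
  rw [← mul_add, ← intervalIntegral.integral_add
    (Continuous.intervalIntegrable (by fun_prop) _ _)
    (Continuous.intervalIntegrable (by fun_prop) _ _), mul_div_assoc,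
    ← intervalIntegral.integral_div]
  congr 2
  ext t
  have := Real.two_mul_cos_mul_cos (s * t) (σ * t)
  rw [sub_mul, add_mul]
  linarith

/-- Uniqueness of the coefficients of an absolutely convergent cosine series. -/
theorem tsum_fiber_eq_zero_of_tsum_cos_eq_zero {b : ℕ → ℂ} {s : ℕ → ℝ} (hs : ∀ k, 0 ≤ s k)
    (hb : Summable fun k => ‖b k‖)
    (h0 : ∀ t ≥ 0, ∑' k, (Real.cos (s k * t)) • b k = 0) {σ : ℝ} (hσ : 0 ≤ σ) :
    ∑' k, (if s k = σ then b k else 0) = 0 := by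
  have hcos : ∀ x y : ℝ, |Real.cos x * Real.cos y| ≤ 1 := fun x y => by
    rw [abs_mul]
    exact mul_le_one₀ (Real.abs_cos_le_one x) (abs_nonneg _) (Real.abs_cos_le_one y)
  -- Multiply the series by $\cos\sigma t$ and average over $[0,T]$ termwise; the bound $\|b_k\|$
  -- serves both here and for $T\to\infty$.
  have hint : ∀ T > 0, ∑' k, (T⁻¹ * ∫ t in (0 : ℝ)..T, Real.cos (s k * t) * Real.cos (σ * t)) • b k
      = 0 := by
    intro T hT
    have h := intervalIntegral.hasSum_integral_of_dominated_convergence (μ := volume)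
      (a := 0) (b := T) (F := fun k t => (Real.cos (s k * t) * Real.cos (σ * t)) • b k)
      (f := fun _ => 0) (fun k _ => ‖b k‖)
      (fun k => Continuous.aestronglyMeasurable (by fun_prop))
      (fun k => Eventually.of_forall fun t _ => by
        rw [norm_smul, Real.norm_eq_abs]
        exact mul_le_of_le_one_left (norm_nonneg _) (hcos _ _))
      (Eventually.of_forall fun t _ => hb) (by simp)
      (Eventually.of_forall fun t ht => by
        rw [uIoc_of_le hT.le] at ht
        have hsum : Summable fun k => Real.cos (s k * t) • b k :=
          .of_norm_bounded hb fun k => by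
            rw [norm_smul, Real.norm_eq_abs]
            exact mul_le_of_le_one_left (norm_nonneg _) (Real.abs_cos_le_one _)
        have h1 := (hsum.hasSum).const_smul (Real.cos (σ * t))
        rw [h0 t ht.1.le, smul_zero] at h1
        simpa only [smul_smul, mul_comm (Real.cos (σ * t))] using h1)
    have h2 := (h.const_smul (T⁻¹)).tsum_eq
    simp only [intervalIntegral.integral_zero, smul_zero] at h2
    rw [← h2]
    refine tsum_congr fun k => ?_
    rw [intervalIntegral.integral_smul_const, smul_smul]
  have hlim := tendsto_tsum_of_dominated_convergence (𝓕 := atTop) (bound := fun k => ‖b k‖)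
    (f := fun (T : ℝ) k =>
      (T⁻¹ * ∫ t in (0 : ℝ)..T, Real.cos (s k * t) * Real.cos (σ * t)) • b k) hb
    (fun k => (tendsto_mean_cos_mul_cos (hs k) hσ).smul_const (b k))
    (by
      filter_upwards [eventually_gt_atTop 0] with T hT k
      rw [norm_smul]
      refine mul_le_of_le_one_left (norm_nonneg _) ?_
      have h := intervalIntegral.norm_integral_le_of_norm_le_const (a := 0) (b := T) (C := 1)
        (f := fun t => Real.cos (s k * t) * Real.cos (σ * t)) fun t _ => hcos _ _
      rw [norm_mul, norm_inv, Real.norm_eq_abs, abs_of_pos hT]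
      rw [sub_zero, one_mul, abs_of_pos hT] at h
      calc _ ≤ T⁻¹ * T := by gcongr
        _ = 1 := inv_mul_cancel₀ hT.ne')
  have hzero : Tendsto (fun T : ℝ => ∑' k,
      (T⁻¹ * ∫ t in (0 : ℝ)..T, Real.cos (s k * t) * Real.cos (σ * t)) • b k) atTop (𝓝 0) :=
    tendsto_const_nhds.congr' (by
      filter_upwards [eventually_gt_atTop 0] with T hT using (hint T hT).symm)
  have huniq := tendsto_nhds_unique hlim hzero
  have hκ : ((1 + if σ = 0 then (1 : ℝ) else 0) / 2) ≠ 0 := by split_ifs <;> norm_num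
  have e : ∀ k, ((if s k = σ then (1 : ℝ) else 0) * ((1 + if σ = 0 then 1 else 0) / 2)) • b k =
      ((1 + if σ = 0 then (1 : ℝ) else 0) / 2) • (if s k = σ then b k else 0) := by
    intro k
    by_cases h : s k = σ <;> simp [h]
  simp_rw [e] at huniq
  rw [tsum_const_smul''] at huniq
  exact (smul_eq_zero.1 huniq).resolve_left hκ

/-- At $0$ the odd derivatives of the cosine transform vanish by parity and the even ones are, up to
sign, the moments. Its $n$-th derivative is bounded by the $n$-th absolute moment, so
Denjoy–Carleman applies. -/
theorem tsum_cos_eq_zero {b : ℕ → ℂ} {s : ℕ → ℝ} (hs : ∀ k, 0 ≤ s k)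
    (hsum : ∀ n : ℕ, Summable fun k => s k ^ n * ‖b k‖)
    (hpos : ∀ n : ℕ, 0 < ∑' k, s k ^ n * ‖b k‖)
    (hdiv : ¬ Summable fun n : ℕ => (∑' k, s k ^ n * ‖b k‖) / ∑' k, s k ^ (n + 1) * ‖b k‖)
    (hmom : ∀ m : ℕ, ∑' k, s k ^ (2 * m) • b k = 0) (t : ℝ) (ht : 0 ≤ t) :
    ∑' k, (Real.cos (s k * t)) • b k = 0 := by
  have hbd : ∀ (n k : ℕ) (t : ℝ), ‖(Real.cos (s k * t + n * (Real.pi / 2)) * s k ^ n) • b k‖ ≤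
      s k ^ n * ‖b k‖ := by
    intro n k t
    rw [norm_smul, norm_mul, norm_pow, Real.norm_eq_abs, Real.norm_eq_abs, abs_of_nonneg (hs k)]
    have := Real.abs_cos_le_one (s k * t + n * (Real.pi / 2))
    have := hs k
    calc _ ≤ 1 * s k ^ n * ‖b k‖ := by gcongr
      _ = _ := by ring
  have main := eq_zero_of_flat_of_not_summable
    -- The phase $n\pi/2$ puts all derivatives of the cosine into one formula.
    (u := fun n t => ∑' k, (Real.cos (s k * t + n * (Real.pi / 2)) * s k ^ n) • b k)
    (M := fun n => ∑' k, s k ^ n * ‖b k‖) ?_ ?_ hpos ?_ hdiv ?_ t ht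
  · simpa using main
  · intro n t
    refine hasDerivAt_tsum (hsum (n + 1))
      (g := fun k t => (Real.cos (s k * t + n * (Real.pi / 2)) * s k ^ n) • b k)
      (g' := fun k t => (Real.cos (s k * t + (n + 1 : ℕ) * (Real.pi / 2)) * s k ^ (n + 1)) • b k)
      (y₀ := 0) (fun k y => ?_) (fun k y => hbd (n + 1) k y) ?_ t
    · have h1 : HasDerivAt (fun y => s k * y + n * (Real.pi / 2)) (s k * 1) y :=
        ((hasDerivAt_id y).const_mul (s k)).add_const _
      have h2 := ((h1.cos).mul_const (s k ^ n)).smul_const (b k)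
      refine h2.congr_deriv ?_
      have : s k * y + ((n + 1 : ℕ) : ℝ) * (Real.pi / 2) =
          s k * y + n * (Real.pi / 2) + Real.pi / 2 := by push_cast; ring
      rw [this, Real.cos_add_pi_div_two]
      congr 1; ring
    · exact .of_norm_bounded (hsum n) fun k => hbd n k 0
  · intro n t
    exact tsum_of_norm_bounded (hsum n).hasSum fun k => hbd n k t
  · intro n
    set M := fun n : ℕ => ∑' k, s k ^ n * ‖b k‖ with hM
    change M (n + 1) ^ 2 ≤ M n * M (n + 2)
    have p0 : 0 < M n := hpos n
    have p1 : 0 < M (n + 1) := hpos (n + 1)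
    -- Log-convexity of the moments: sum $s_k^n\|b_k\|(y-xs_k)^2\ge0$, then take $x=M_n$,
    -- $y=M_{n+1}$.
    have h : ∀ x y : ℝ, 2 * x * y * M (n + 1) ≤ y ^ 2 * M n + x ^ 2 * M (n + 2) := by
      intro x y
      simp only [hM]
      rw [← tsum_mul_left, ← tsum_mul_left, ← tsum_mul_left,
        ← ((hsum n).mul_left _).tsum_add ((hsum (n + 2)).mul_left _)]
      refine ((hsum (n + 1)).mul_left _).tsum_le_tsum (fun k => ?_)
        (((hsum n).mul_left _).add ((hsum (n + 2)).mul_left _))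
      have hk : 0 ≤ s k ^ n * ‖b k‖ := mul_nonneg (pow_nonneg (hs k) _) (norm_nonneg _)
      have := mul_nonneg hk (sq_nonneg (y - x * s k))
      rw [pow_succ (s k) n, pow_add (s k) n 2]
      nlinarith [this]
    have : M n * (M (n + 1) ^ 2) ≤ M n * (M n * M (n + 2)) := by nlinarith [h (M n) (M (n + 1))]
    exact le_of_mul_le_mul_left this p0
  · intro n
    rcases Nat.even_or_odd' n with ⟨m, rfl | rfl⟩
    · have : ∀ k, (Real.cos (s k * 0 + (2 * m : ℕ) * (Real.pi / 2)) * s k ^ (2 * m)) • b k =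
          Real.cos (m * Real.pi) • (s k ^ (2 * m) • b k) := by
        intro k
        rw [smul_smul]; congr 3; push_cast; ring
      simp_rw [this]
      rw [tsum_const_smul'', hmom, smul_zero]
    · have : ∀ k, Real.cos (s k * 0 + (2 * m + 1 : ℕ) * (Real.pi / 2)) = 0 := by
        intro k
        rw [show s k * 0 + ((2 * m + 1 : ℕ) : ℝ) * (Real.pi / 2) = m * Real.pi + Real.pi / 2 by
          push_cast; ring, Real.cos_add_pi_div_two, Real.sin_nat_mul_pi, neg_zero]
      simp_rw [this, zero_mul, zero_smul, tsum_zero]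

/-- A discrete complex measure on `[0, ∞)` all of whose moments vanish, and whose absolute moments
satisfy Carleman's condition, has no atoms. -/
theorem tsum_fiber_eq_zero_of_moments {b : ℕ → ℂ} {s : ℕ → ℝ} (hs : ∀ k, 0 ≤ s k)
    (hsum : ∀ m : ℕ, Summable fun k => s k ^ (2 * m) * ‖b k‖)
    (hmom : ∀ m : ℕ, ∑' k, s k ^ (2 * m) • b k = 0) {C : ℝ} (hC : 0 < C) {L : ℕ → ℝ}
    (hL : ∀ m : ℕ, ∑' k, s k ^ (2 * m) * ‖b k‖ ≤ C * L m)
    (hCar : ∑' m : ℕ, ENNReal.ofReal (L (m + 1)) ^ (-(1 / (2 * ((m : ℝ) + 1)))) = ⊤)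
    {σ : ℝ} (hσ : 0 ≤ σ) : ∑' k, (if s k = σ then b k else 0) = 0 := by
  have hsum' : ∀ n : ℕ, Summable fun k => s k ^ n * ‖b k‖ := by
    intro n
    rcases Nat.even_or_odd' n with ⟨m, rfl | rfl⟩
    · exact hsum m
    · refine Summable.of_nonneg_of_le (fun k => mul_nonneg (pow_nonneg (hs k) _) (norm_nonneg _))
        (fun k => ?_) ((hsum m).add (hsum (m + 1)))
      rw [← add_mul]
      gcongr
      have := pow_nonneg (hs k) (2 * m)
      rw [show 2 * (m + 1) = 2 * m + 2 by ring, pow_succ, pow_add]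
      nlinarith [mul_nonneg this (sq_nonneg (s k - 1))]
  have hb : Summable fun k => ‖b k‖ := by simpa using hsum' 0
  -- If all the mass sits at $0$, the higher absolute moments vanish and the ratios are useless; the
  -- zeroth moment then settles the claim.
  by_cases hdeg : ∀ k, s k = 0 ∨ b k = 0
  · rcases hσ.eq_or_lt with rfl | hσ'
    · have h0 := hmom 0
      simp only [mul_zero, pow_zero, one_smul] at h0
      refine (tsum_congr fun k => ?_).trans h0
      rcases hdeg k with h | h <;> simp [h]
    · convert tsum_zero (α := ℂ) (β := ℕ) with k
      rcases hdeg k with h | h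
      · simp [h, hσ'.ne]
      · simp [h]
  push Not at hdeg
  obtain ⟨k₀, hk1, hk2⟩ := hdeg
  have hpos : ∀ n : ℕ, 0 < ∑' k, s k ^ n * ‖b k‖ := fun n =>
    (hsum' n).tsum_pos (fun k => mul_nonneg (pow_nonneg (hs k) _) (norm_nonneg _)) k₀
      (mul_pos (pow_pos ((hs k₀).lt_of_ne' hk1) _) (norm_pos_iff.2 hk2))
  refine tsum_fiber_eq_zero_of_tsum_cos_eq_zero hs hb
    (fun t ht => tsum_cos_eq_zero hs hsum' hpos ?_ hmom t ht) hσ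
  intro hratio
  set M := fun n : ℕ => ∑' k, s k ^ n * ‖b k‖ with hM
  have h1 := summable_rpow_of_summable_ratio M hpos hratio
  -- Only the terms $n=2m+1$ are kept: there $n+1=2(m+1)$, an even moment, which $L_{m+1}$ controls.
  -- The factor `max 1 (C / M 0)` below bounds $(C/M_0)^p$ for all $p\in[0,1]$.
  have hinj : Function.Injective fun m : ℕ => 2 * m + 1 := fun x y h => by simpa using h
  have h2 := (h1.comp_injective hinj).mul_left (max 1 (C / M 0))
  refine (Summable.tsum_ofReal_ne_top h2) ?_
  rw [eq_top_iff, ← hCar]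
  refine ENNReal.tsum_le_tsum fun m => ?_
  have hLm : M (2 * (m + 1)) / C ≤ L (m + 1) := by
    rw [div_le_iff₀' hC]; exact hL (m + 1)
  have pM : 0 < M (2 * (m + 1)) := hpos _
  have p0 : 0 < M 0 := hpos 0
  -- Positivity excludes the value `⊤` that a negative power of zero takes in `ENNReal`.
  have pL : 0 < L (m + 1) := lt_of_lt_of_le (by positivity) hLm
  rw [ENNReal.ofReal_rpow_of_pos pL]
  apply ENNReal.ofReal_le_ofReal
  set p : ℝ := 1 / (2 * ((m : ℝ) + 1)) with hp
  have hp0 : 0 ≤ p := by positivity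
  have hp1 : p ≤ 1 := by
    rw [hp, div_le_one (by positivity)]
    have : (0 : ℝ) ≤ m := by positivity
    linarith
  have e : (1 : ℝ) / ((2 * m + 1 : ℕ) + 1) = p := by
    rw [hp]; push_cast; ring
  simp only [Function.comp]
  rw [e, show 2 * m + 1 + 1 = 2 * (m + 1) by ring]
  calc L (m + 1) ^ (-p) ≤ (M (2 * (m + 1)) / C) ^ (-p) :=
        Real.rpow_le_rpow_of_nonpos (by positivity) hLm (by linarith)
    _ = (C / M 0) ^ p * (M 0 / M (2 * (m + 1))) ^ p := by
        rw [Real.rpow_neg (by positivity), ← Real.inv_rpow (by positivity),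
          ← Real.mul_rpow (by positivity) (by positivity)]
        congr 1; field_simp
    _ ≤ _ := by
        gcongr
        rcases le_total (C / M 0) 1 with h | h
        · exact (Real.rpow_le_one (by positivity) h hp0).trans (le_max_left _ _)
        · exact ((Real.rpow_le_rpow_of_exponent_le h hp1).trans_eq (Real.rpow_one _)).trans
            (le_max_right _ _)

/-! ### Local estimates for ordinary differential operators -/

/-- `U 0, …, U n` are a function of class `C^n` on `(0, ∞)` and its successive derivatives. -/
structure IsJet (n : ℕ) (U : ℕ → ℝ → ℂ) : Prop where
  hasDerivAt : ∀ j < n, ∀ x > 0, HasDerivAt (U j) (U (j + 1) x) x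
  continuousOn_top : ContinuousOn (U n) (Ioi 0)

namespace IsJet

variable {n : ℕ} {U V : ℕ → ℝ → ℂ}

theorem continuousOn (hU : IsJet n U) {j : ℕ} (hj : j ≤ n) : ContinuousOn (U j) (Ioi 0) := by
  rcases hj.eq_or_lt with rfl | h
  · exact hU.continuousOn_top
  · exact fun x hx => (hU.hasDerivAt j h x hx).continuousAt.continuousWithinAt

theorem continuousOn_uIcc (hU : IsJet n U) {j : ℕ} (hj : j ≤ n) {a b : ℝ} (ha : 0 < a)
    (hb : 0 < b) : ContinuousOn (U j) (uIcc a b) :=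
  (hU.continuousOn hj).mono fun _ hx => lt_of_lt_of_le (lt_min ha hb) hx.1

theorem sub (hU : IsJet n U) (hV : IsJet n V) : IsJet n fun j x => U j x - V j x :=
  ⟨fun j hj x hx => (hU.hasDerivAt j hj x hx).sub (hV.hasDerivAt j hj x hx),
    hU.continuousOn_top.sub hV.continuousOn_top⟩

theorem sum_mul {ι : Type*} (s : Finset ι) (c : ι → ℂ) {W : ι → ℕ → ℝ → ℂ}
    (hW : ∀ i ∈ s, IsJet n (W i)) : IsJet n fun j x => ∑ i ∈ s, c i * W i j x :=
  ⟨fun j hj x hx => HasDerivAt.fun_sum fun i hi => ((hW i hi).hasDerivAt j hj x hx).const_mul _,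
    continuousOn_finsetSum _ fun i hi => continuousOn_const.mul (hW i hi).continuousOn_top⟩

theorem of_contDiffOn {u : ℝ → ℂ} (hu : ContDiffOn ℝ n u (Ioi 0)) :
    IsJet n fun j => iteratedDeriv j u := by
  have hev : ∀ j, EqOn (iteratedDerivWithin j u (Ioi 0)) (iteratedDeriv j u) (Ioi 0) :=
    fun j => iteratedDerivWithin_of_isOpen isOpen_Ioi
  refine ⟨fun j hj x hx => ?_, ?_⟩
  · have h1 := hu.differentiableOn_iteratedDerivWithin (m := j) (by exact_mod_cast hj)
      isOpen_Ioi.uniqueDiffOn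
    have h2 : DifferentiableAt ℝ (iteratedDeriv j u) x :=
      ((h1.congr fun y hy => (hev j hy).symm) x hx).differentiableAt (Ioi_mem_nhds hx)
    rw [iteratedDeriv_succ]
    exact h2.hasDerivAt
  · exact (hu.continuousOn_iteratedDerivWithin le_rfl isOpen_Ioi.uniqueDiffOn).congr
      fun y hy => (hev n hy).symm

theorem intervalIntegrable_norm (hU : IsJet n U) {j : ℕ} (hj : j ≤ n) {a b : ℝ} (ha : 0 < a)
    (hb : 0 < b) : IntervalIntegrable (fun x => ‖U j x‖) volume a b :=
  (hU.continuousOn_uIcc hj ha hb).norm.intervalIntegrable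

/-- Integration by parts moves all derivatives onto $\eta$, without boundary terms. The induction
ranges over all $\eta$, since each step passes to `deriv η`. -/
theorem integral_smul_le (n : ℕ) {a b : ℝ} (ha : 0 < a) (hab : a < b) (j : ℕ) (hj : j ≤ n) :
    ∀ η : ℝ → ℝ, ContDiff ℝ ((⊤ : ℕ∞) : WithTop ℕ∞) η → tsupport η ⊆ Ioo a b →
      ∃ K ≥ 0, ∀ U, IsJet n U → ‖∫ x in a..b, η x • U j x‖ ≤ K * ∫ x in a..b, ‖U 0 x‖ := by
  have hb := ha.trans hab
  induction j with
  | zero =>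
    intro η hη _
    obtain ⟨K, hK⟩ := isCompact_Icc.exists_bound_of_continuousOn (hη.continuous.continuousOn
      (s := Icc a b))
    refine ⟨K, (norm_nonneg _).trans (hK a ⟨le_rfl, hab.le⟩), fun U hU => ?_⟩
    rw [← intervalIntegral.integral_const_mul]
    refine intervalIntegral.norm_integral_le_of_norm_le hab.le ?_
      ((hU.intervalIntegrable_norm hj ha hb).const_mul K)
    refine Eventually.of_forall fun x hx => ?_
    rw [norm_smul]
    gcongr
    exact hK x ⟨hx.1.le, hx.2⟩
  | succ j ih =>
    intro η hη hsupp
    have hη' := (contDiff_infty_iff_deriv.1 hη).2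
    obtain ⟨K, hK0, hK⟩ := ih (by omega) (deriv η) hη'
      ((closure_minimal support_deriv_subset (isClosed_tsupport η)).trans hsupp)
    refine ⟨K, hK0, fun U hU => ?_⟩
    have hout : ∀ x, x ∉ Ioo a b → η x = 0 := fun x hx =>
      image_eq_zero_of_notMem_tsupport fun h => hx (hsupp h)
    have hd : Differentiable ℝ η := hη.differentiable (by simp)
    rw [intervalIntegral.integral_smul_deriv_eq_deriv_smul_of_hasDerivAt (v := U j) (u' := deriv η)
      hd.continuous.continuousOn (hU.continuousOn_uIcc (by omega) ha hb)
      (fun x _ => (hd x).hasDerivAt)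
      (fun x hx => hU.hasDerivAt j (by omega) x ((lt_min ha hb).trans hx.1))
      (hη'.continuous.intervalIntegrable _ _)
      (hU.continuousOn_uIcc hj ha hb).intervalIntegrable,
      hout a (by simp), hout b (by simp)]
    simpa using hK U hU

/-- The mean of `U j` against a normalized bump is controlled by the $L^1$ norm of `U 0`, and `U j
x` differs from that mean by at most the $L^1$ norm of `U (j + 1)`. -/
theorem exists_norm_le_add_integral (n : ℕ) {a b : ℝ} (ha : 0 < a) (hab : a < b) :
    ∃ K ≥ 0, ∀ U, IsJet n U → ∀ j < n, ∀ x ∈ Icc a b,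
      ‖U j x‖ ≤ K * (∫ x in a..b, ‖U 0 x‖) + ∫ x in a..b, ‖U (j + 1) x‖ := by
  have hb := ha.trans hab
  let φ : ContDiffBump ((a + b) / 2) := ⟨(b - a) / 8, (b - a) / 4, by linarith, by linarith⟩
  let η : ℝ → ℝ := φ.normed volume
  have hη : ContDiff ℝ ((⊤ : ℕ∞) : WithTop ℕ∞) η := φ.contDiff_normed
  have hsupp : tsupport η ⊆ Ioo a b := by
    rw [φ.tsupport_normed_eq, Real.closedBall_eq_Icc]
    intro x hx
    have h1 : (a + b) / 2 - (b - a) / 4 ≤ x := hx.1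
    have h2 : x ≤ (a + b) / 2 + (b - a) / 4 := hx.2
    exact ⟨by linarith, by linarith⟩
  have hη0 : ∀ x, 0 ≤ η x := φ.nonneg_normed
  have hη1 : ∫ x in a..b, η x = 1 := by
    rw [intervalIntegral.integral_eq_integral_of_support_subset, φ.integral_normed]
    exact (subset_tsupport η).trans (hsupp.trans Ioo_subset_Ioc_self)
  have hK : ∀ j, ∃ K ≥ 0, j ≤ n → ∀ U, IsJet n U →
      ‖∫ x in a..b, η x • U j x‖ ≤ K * ∫ x in a..b, ‖U 0 x‖ := by
    intro j
    by_cases hj : j ≤ n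
    · obtain ⟨K, h0, h⟩ := integral_smul_le n ha hab j hj η hη hsupp
      exact ⟨K, h0, fun _ => h⟩
    · exact ⟨0, le_rfl, fun h => absurd h hj⟩
  choose K hK0 hK using hK
  refine ⟨∑ j ∈ Finset.range n, K j, Finset.sum_nonneg fun j _ => hK0 j, fun U hU j hj x hx => ?_⟩
  have hI0 : 0 ≤ ∫ x in a..b, ‖U 0 x‖ :=
    intervalIntegral.integral_nonneg hab.le fun _ _ => norm_nonneg _
  have hint := hU.intervalIntegrable_norm (j := j + 1) hj ha hb
  have hdiff : ∀ y ∈ Icc a b, ‖U j x - U j y‖ ≤ ∫ x in a..b, ‖U (j + 1) x‖ := by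
    intro y hy
    have hx0 := ha.trans_le hx.1
    have hy0 := ha.trans_le hy.1
    rw [← intervalIntegral.integral_eq_sub_of_hasDerivAt
      (fun z hz => hU.hasDerivAt j hj z (lt_of_lt_of_le (lt_min hy0 hx0) hz.1))
      (hU.continuousOn_uIcc hj hy0 hx0).intervalIntegrable]
    refine intervalIntegral.norm_integral_le_integral_norm_uIoc.trans ?_
    rw [intervalIntegral.integral_of_le hab.le]
    refine setIntegral_mono_set ((intervalIntegrable_iff_integrableOn_Ioc_of_le hab.le).1 hint)
      (Eventually.of_forall fun _ => norm_nonneg _) (Eventually.of_forall ?_)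
    exact Ioc_subset_Ioc (le_min hy.1 hx.1) (max_le hy.2 hx.2)
  have hηc : Continuous η := hη.continuous
  have hUc := hU.continuousOn_uIcc hj.le ha hb
  have hsplit : U j x = (∫ y in a..b, η y • U j y) + ∫ y in a..b, η y • (U j x - U j y) := by
    rw [← intervalIntegral.integral_add]
    · simp_rw [← smul_add, add_sub_cancel]
      rw [intervalIntegral.integral_smul_const, hη1, one_smul]
    · exact (hηc.continuousOn.smul hUc).intervalIntegrable
    · exact (hηc.continuousOn.smul (continuousOn_const.sub hUc)).intervalIntegrable
  have h2 : ‖∫ y in a..b, η y • (U j x - U j y)‖ ≤ ∫ x in a..b, ‖U (j + 1) x‖ := by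
    have := intervalIntegral.norm_integral_le_of_norm_le (μ := volume) hab.le
      (f := fun y => η y • (U j x - U j y))
      (g := fun y => η y * ∫ x in a..b, ‖U (j + 1) x‖) (Eventually.of_forall fun y hy => by
        rw [norm_smul, Real.norm_eq_abs, abs_of_nonneg (hη0 y)]
        exact mul_le_mul_of_nonneg_left (hdiff y ⟨hy.1.le, hy.2⟩) (hη0 y))
      ((hηc.mul continuous_const).intervalIntegrable _ _)
    rwa [intervalIntegral.integral_mul_const, hη1, one_mul] at this
  rw [hsplit]
  refine (norm_add_le _ _).trans (add_le_add ((hK j hj.le U hU).trans ?_) h2)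
  gcongr
  exact Finset.single_le_sum (f := K) (fun i _ => hK0 i) (Finset.mem_range.2 hj)

/-- Descending induction from $j=n-1$. On an interval of length at most 1 the coefficient of
$\int\|U_n\|$ stays equal to 1, independent of the interval, so that this term can later be
absorbed. -/
theorem exists_norm_le_add_integral_top (n : ℕ) {a b : ℝ} (ha : 0 < a) (hab : a < b)
    (hlen : b - a ≤ 1) :
    ∃ K ≥ 0, ∀ U, IsJet n U → ∀ j < n, ∀ x ∈ Icc a b,
      ‖U j x‖ ≤ K * (∫ x in a..b, ‖U 0 x‖) + ∫ x in a..b, ‖U n x‖ := by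
  have hb := ha.trans hab
  obtain ⟨K, hK0, hK⟩ := exists_norm_le_add_integral n ha hab
  refine ⟨n * K, by positivity, fun U hU => ?_⟩
  have hI0 : 0 ≤ ∫ x in a..b, ‖U 0 x‖ :=
    intervalIntegral.integral_nonneg hab.le fun _ _ => norm_nonneg _
  have claim : ∀ d j, j + (d + 1) = n → ∀ x ∈ Icc a b, ‖U j x‖ ≤
      ((d + 1 : ℕ) : ℝ) * K * (∫ x in a..b, ‖U 0 x‖) + ∫ x in a..b, ‖U n x‖ := by
    intro d
    induction d with
    | zero =>
      intro j hj x hx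
      simpa [← hj] using hK U hU j (by omega) x hx
    | succ d ih =>
      intro j hj x hx
      set B := ((d + 1 : ℕ) : ℝ) * K * (∫ x in a..b, ‖U 0 x‖) + ∫ x in a..b, ‖U n x‖ with hB
      have h1 := ih (j + 1) (by omega)
      have hB0 : 0 ≤ B := (norm_nonneg _).trans (h1 x hx)
      have h2 : ∫ x in a..b, ‖U (j + 1) x‖ ≤ B := by
        calc _ ≤ ∫ x in a..b, B := intervalIntegral.integral_mono_on hab.le
              (hU.intervalIntegrable_norm (by omega) ha hb) (by simp) h1
          _ = (b - a) * B := by simp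
          _ ≤ 1 * B := by gcongr
          _ = B := one_mul B
      refine (hK U hU j (by omega) x hx).trans ?_
      have : ((d + 1 + 1 : ℕ) : ℝ) * K * (∫ x in a..b, ‖U 0 x‖) + ∫ x in a..b, ‖U n x‖ =
          K * (∫ x in a..b, ‖U 0 x‖) + B := by rw [hB]; push_cast; ring
      rw [this]
      gcongr
  intro j hj x hx
  refine (claim (n - j - 1) j (by omega) x hx).trans ?_
  gcongr
  omega

/-- The interior estimate for a monic operator on a short interval. -/
theorem exists_norm_le_of_short (n : ℕ) {a b Q : ℝ} (ha : 0 < a) (hab : a < b) (hlen : b - a ≤ 1)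
    (q : ℕ → ℝ → ℂ) (hq : ∀ j < n, ContinuousOn (q j) (Icc a b))
    (hQ : ∀ j < n, ∀ x ∈ Icc a b, ‖q j x‖ ≤ Q) (hshort : n * Q * (b - a) ≤ 1 / 2) :
    ∃ C ≥ 0, ∀ U, IsJet n U → ∀ j < n, ∀ x ∈ Icc a b,
      ‖U j x‖ ≤ C * ((∫ x in a..b, ‖U 0 x‖) +
        ∫ x in a..b, ‖U n x + ∑ j ∈ Finset.range n, q j x * U j x‖) := by
  have hb := ha.trans hab
  obtain ⟨K, hK0, hK⟩ := exists_norm_le_add_integral_top n ha hab hlen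
  refine ⟨2 * K + 2, by positivity, fun U hU j hj x hx => ?_⟩
  set I0 := ∫ x in a..b, ‖U 0 x‖ with hI0d
  set In := ∫ x in a..b, ‖U n x‖ with hInd
  set R := ∫ x in a..b, ‖U n x + ∑ j ∈ Finset.range n, q j x * U j x‖ with hRd
  have hI0 : 0 ≤ I0 := intervalIntegral.integral_nonneg hab.le fun _ _ => norm_nonneg _
  have hIn : 0 ≤ In := intervalIntegral.integral_nonneg hab.le fun _ _ => norm_nonneg _
  have hR : 0 ≤ R := intervalIntegral.integral_nonneg hab.le fun _ _ => norm_nonneg _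
  have hsumc : ContinuousOn (fun x => U n x + ∑ j ∈ Finset.range n, q j x * U j x) (uIcc a b) := by
    refine (hU.continuousOn_uIcc le_rfl ha hb).add (continuousOn_finsetSum _ fun i hi => ?_)
    have hi' := Finset.mem_range.1 hi
    refine ContinuousOn.mul ?_ (hU.continuousOn_uIcc hi'.le ha hb)
    rw [uIcc_of_le hab.le]
    exact hq i hi'
  have hQ0 : 0 ≤ Q := (norm_nonneg _).trans (hQ j hj x hx)
  have hpt : ∀ y ∈ Icc a b, ‖U n y‖ ≤ ‖U n y + ∑ j ∈ Finset.range n, q j y * U j y‖ +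
      n * Q * (K * I0 + In) := by
    intro y hy
    have h1 : ‖∑ j ∈ Finset.range n, q j y * U j y‖ ≤ n * Q * (K * I0 + In) := by
      calc _ ≤ ∑ j ∈ Finset.range n, Q * (K * I0 + In) := by
            refine norm_sum_le_of_le _ fun i hi => ?_
            have hi' := Finset.mem_range.1 hi
            rw [norm_mul]
            exact mul_le_mul (hQ i hi' y hy) (hK U hU i hi' y hy) (norm_nonneg _) hQ0
        _ = _ := by simp; ring
    have h2 := norm_sub_le (U n y + ∑ j ∈ Finset.range n, q j y * U j y)
      (∑ j ∈ Finset.range n, q j y * U j y)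
    rw [add_sub_cancel_right] at h2
    linarith
  have hmain : In ≤ R + (b - a) * (n * Q * (K * I0 + In)) := by
    calc In ≤ ∫ y in a..b, (‖U n y + ∑ j ∈ Finset.range n, q j y * U j y‖ +
          n * Q * (K * I0 + In)) := intervalIntegral.integral_mono_on hab.le
            (hU.intervalIntegrable_norm le_rfl ha hb)
            (hsumc.norm.intervalIntegrable.add (by simp)) hpt
      _ = _ := by
        rw [intervalIntegral.integral_add hsumc.norm.intervalIntegrable (by simp)]
        rw [intervalIntegral.integral_const, smul_eq_mul]
  -- Shortness of the interval lets half of `In` be absorbed on the left: `In ≤ 2 * R + K * I0`.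
  have h3 : (b - a) * (n * Q * (K * I0 + In)) ≤ 1 / 2 * (K * I0 + In) := by
    calc _ = n * Q * (b - a) * (K * I0 + In) := by ring
      _ ≤ _ := by gcongr
  have h4 := hK U hU j hj x hx
  nlinarith [mul_nonneg hK0 hR]

end IsJet

/-! ### Closedness and unique continuation -/

/-- The interior estimate makes the derivatives of order below $n$ converge uniformly, necessarily
to $0$. The top derivative has no such control, so the equation is integrated and a primitive of $g$
is shown to vanish. -/
theorem ae_eq_zero_of_tendsto_monic {n : ℕ} (hn : 0 < n) {a b Q : ℝ} (ha : 0 < a) (hab : a < b)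
    (hlen : b - a ≤ 1) (q : ℕ → ℝ → ℂ) (hq : ∀ j < n, ContinuousOn (q j) (Icc a b))
    (hQ : ∀ j < n, ∀ x ∈ Icc a b, ‖q j x‖ ≤ Q) (hshort : n * Q * (b - a) ≤ 1 / 2)
    {W : ℕ → ℕ → ℝ → ℂ} (hW : ∀ N, IsJet n (W N)) {g : ℝ → ℂ}
    (hg : IntervalIntegrable g volume a b)
    (h0 : Tendsto (fun N => ∫ x in a..b, ‖W N 0 x‖) atTop (𝓝 0))
    (h1 : Tendsto (fun N => ∫ x in a..b,
      ‖W N n x + ∑ j ∈ Finset.range n, q j x * W N j x - g x‖) atTop (𝓝 0)) :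
    ∀ᵐ x, x ∈ Ioo a b → g x = 0 := by
  have hb := ha.trans hab
  obtain ⟨C, hC0, hC⟩ := IsJet.exists_norm_le_of_short n ha hab hlen q hq hQ hshort
  set R : ℕ → ℝ → ℂ := fun N x => W N n x + ∑ j ∈ Finset.range n, q j x * W N j x with hR
  have hterm : ∀ N, ∀ j < n, ContinuousOn (fun x => q j x * W N j x) (Icc a b) := fun N j hj =>
    (hq j hj).mul (by simpa [uIcc_of_le hab.le] using (hW N).continuousOn_uIcc hj.le ha hb)
  have hRc : ∀ N, ContinuousOn (R N) (Icc a b) := fun N =>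
    ContinuousOn.add (by simpa [uIcc_of_le hab.le] using (hW N).continuousOn_uIcc le_rfl ha hb)
      (continuousOn_finsetSum _ fun i hi => hterm N i (Finset.mem_range.1 hi))
  have hRi : ∀ N, IntervalIntegrable (R N) volume a b := fun N =>
    ContinuousOn.intervalIntegrable (by rw [uIcc_of_le hab.le]; exact hRc N)
  set e : ℕ → ℝ := fun N => (∫ x in a..b, ‖W N 0 x‖) + ∫ x in a..b, ‖R N x - g x‖ with he
  have hlim : Tendsto e atTop (𝓝 0) := by simpa using h0.add h1
  have hcauchy : ∀ j < n, UniformCauchySeqOn (fun N => W N j) atTop (Icc a b) := by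
    intro j hj
    rw [Metric.uniformCauchySeqOn_iff]
    intro ε hε
    have hev : ∀ᶠ N in atTop, e N < ε / (2 * (C + 1)) :=
      hlim.eventually_lt_const (by positivity)
    obtain ⟨N₀, hN₀⟩ := eventually_atTop.1 hev
    refine ⟨N₀, fun m hm k hk x hx => ?_⟩
    rw [dist_eq_norm]
    have hb1 := hC _ ((hW m).sub (hW k)) j hj x hx
    have hb2 : (∫ x in a..b, ‖W m 0 x - W k 0 x‖) ≤
        (∫ x in a..b, ‖W m 0 x‖) + ∫ x in a..b, ‖W k 0 x‖ := by
      rw [← intervalIntegral.integral_add ((hW m).intervalIntegrable_norm (Nat.zero_le _) ha hb)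
        ((hW k).intervalIntegrable_norm (Nat.zero_le _) ha hb)]
      exact intervalIntegral.integral_mono hab.le
        (((hW m).sub (hW k)).intervalIntegrable_norm (Nat.zero_le _) ha hb)
        (((hW m).intervalIntegrable_norm (Nat.zero_le _) ha hb).add
          ((hW k).intervalIntegrable_norm (Nat.zero_le _) ha hb)) fun x => norm_sub_le _ _
    have hb3 : (∫ x in a..b, ‖W m n x - W k n x +
          ∑ j ∈ Finset.range n, q j x * (W m j x - W k j x)‖) ≤
        (∫ x in a..b, ‖R m x - g x‖) + ∫ x in a..b, ‖R k x - g x‖ := by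
      -- In differences $g$ cancels, so the estimate uses only convergence of the images.
      have hrw : ∀ x, W m n x - W k n x + ∑ j ∈ Finset.range n, q j x * (W m j x - W k j x) =
          (R m x - g x) - (R k x - g x) := by
        intro x
        simp only [hR, mul_sub, Finset.sum_sub_distrib]
        ring
      simp_rw [hrw]
      rw [← intervalIntegral.integral_add ((hRi m).sub hg).norm ((hRi k).sub hg).norm]
      exact intervalIntegral.integral_mono hab.le
        (((hRi m).sub hg).sub ((hRi k).sub hg)).norm
        (((hRi m).sub hg).norm.add ((hRi k).sub hg).norm) fun x => norm_sub_le _ _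
    have hm' := hN₀ m hm
    have hk' := hN₀ k hk
    calc ‖W m j x - W k j x‖ ≤ C * (e m + e k) := by
          refine hb1.trans (mul_le_mul_of_nonneg_left ?_ hC0)
          simp only [he]
          linarith
      _ ≤ C * (ε / (2 * (C + 1)) + ε / (2 * (C + 1))) := by gcongr
      _ = ε * (C / (C + 1)) := by field_simp; ring
      _ < ε * 1 := by
          gcongr
          rw [div_lt_one (by positivity)]; linarith
      _ = ε := mul_one ε
  have hex : ∀ j, ∃ V : ℝ → ℂ, j < n → TendstoUniformlyOn (fun N => W N j) V atTop (Icc a b) := by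
    intro j
    by_cases hj : j < n
    · have hpt : ∀ x, ∃ v, x ∈ Icc a b → Tendsto (fun N => W N j x) atTop (𝓝 v) := by
        intro x
        by_cases hx : x ∈ Icc a b
        · obtain ⟨v, hv⟩ := cauchySeq_tendsto_of_complete ((hcauchy j hj).cauchySeq hx)
          exact ⟨v, fun _ => hv⟩
        · exact ⟨0, fun h => absurd h hx⟩
      choose V hV using hpt
      exact ⟨V, fun _ => (hcauchy j hj).tendstoUniformlyOn_of_tendsto hV⟩
    · exact ⟨0, fun h => absurd h hj⟩
  choose V hV using hex
  have hV0 : ∀ j < n, ∀ x ∈ Ioo a b, V j x = 0 := by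
    intro j
    induction j with
    | zero =>
      intro hj
      have hVc : ContinuousOn (V 0) (Icc a b) := (hV 0 hj).continuousOn
        (Eventually.of_forall fun N => by
          simpa [uIcc_of_le hab.le] using (hW N).continuousOn_uIcc (Nat.zero_le _) ha hb).frequently
      have hVi : IntervalIntegrable (fun x => ‖V 0 x‖) volume a b :=
        ContinuousOn.intervalIntegrable (by rw [uIcc_of_le hab.le]; exact hVc.norm)
      have hle : ∫ x in a..b, ‖V 0 x‖ ≤ 0 := by
        refine le_of_forall_pos_le_add fun ε hε => ?_
        have hd : 0 < b - a := sub_pos.2 hab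
        have hu := Metric.tendstoUniformlyOn_iff.1 (hV 0 hj) (ε / (2 * (b - a))) (by positivity)
        have hs := h0.eventually_lt_const (u := ε / 2) (by positivity)
        obtain ⟨N, hN1, hN2⟩ := (hu.and hs).exists
        have hWi := (hW N).intervalIntegrable_norm (Nat.zero_le _) ha hb
        calc ∫ x in a..b, ‖V 0 x‖ ≤ ∫ x in a..b, (ε / (2 * (b - a)) + ‖W N 0 x‖) := by
              refine intervalIntegral.integral_mono_on hab.le hVi
                (IntervalIntegrable.add (by simp) hWi) fun x hx => ?_
              have := hN1 x hx
              rw [dist_eq_norm] at this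
              have h3 := norm_sub_norm_le (V 0 x) (W N 0 x)
              linarith
          _ = ε / 2 + ∫ x in a..b, ‖W N 0 x‖ := by
              rw [intervalIntegral.integral_add (by simp) hWi, intervalIntegral.integral_const,
                smul_eq_mul]
              field_simp
          _ ≤ 0 + ε := by linarith
      have heq : ∫ x in a..b, ‖V 0 x‖ = 0 := le_antisymm hle
        (intervalIntegral.integral_nonneg hab.le fun _ _ => norm_nonneg _)
      have hae := (intervalIntegral.integral_eq_zero_iff_of_le_of_nonneg_ae hab.le
        (Eventually.of_forall fun x => norm_nonneg (V 0 x)) hVi).1 heq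
      have hae' : (fun x => ‖V 0 x‖) =ᵐ[volume.restrict (Icc a b)] fun _ => 0 := by
        rw [← restrict_Ioc_eq_restrict_Icc]; exact hae
      intro x hx
      have := Measure.eqOn_Icc_of_ae_eq volume hab.ne hae' hVc.norm continuousOn_const
        (Ioo_subset_Icc_self hx)
      simpa using this
    | succ j ih =>
      intro hj x hx
      have hd : HasDerivAt (V j) (V (j + 1) x) x :=
        hasDerivAt_of_tendstoUniformlyOn isOpen_Ioo ((hV (j + 1) hj).mono Ioo_subset_Icc_self)
          (Eventually.of_forall fun N y hy => (hW N).hasDerivAt j (by omega) y (ha.trans hy.1))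
          (fun y hy => (hV j (by omega)).tendsto_at (Ioo_subset_Icc_self hy)) hx
      have hz : HasDerivAt (V j) 0 x := (hasDerivAt_const x (0 : ℂ)).congr_of_eventuallyEq (by
        filter_upwards [Ioo_mem_nhds hx.1 hx.2] with y hy using ih (by omega) y hy)
      exact hd.unique hz
  have hsmall : ∀ ε > 0, ∀ᶠ N in atTop, ∀ j ∈ Finset.range n, ∀ x ∈ Ioo a b, ‖W N j x‖ < ε := by
    intro ε hε
    rw [eventually_all_finset]
    intro j hj
    have hj' := Finset.mem_range.1 hj
    filter_upwards [Metric.tendstoUniformlyOn_iff.1 (hV j hj') ε hε] with N hN x hx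
    have := hN x (Ioo_subset_Icc_self hx)
    rwa [hV0 j hj' x hx, dist_zero_left] at this
  set c := (a + b) / 2 with hc
  have hcI : c ∈ Ioo a b := ⟨by rw [hc]; linarith, by rw [hc]; linarith⟩
  have hQ0 : 0 ≤ Q := (norm_nonneg _).trans (hQ 0 hn c (Ioo_subset_Icc_self hcI))
  have hprim : ∀ x ∈ Ioo a b, ∫ t in c..x, g t = 0 := by
    intro x hx
    have hsub : uIcc c x ⊆ Ioo a b := ordConnected_Ioo.uIcc_subset hcI hx
    have hsub' : uIcc c x ⊆ Icc a b := hsub.trans Ioo_subset_Icc_self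
    have hsubu : uIcc c x ⊆ uIcc a b := by rwa [uIcc_of_le hab.le]
    have hxc : |x - c| ≤ b - a := by
      rw [abs_le]; constructor <;> linarith [hx.1, hx.2, hcI.1, hcI.2]
    set D := 1 + 2 + n * (Q * (b - a)) with hD
    have hD0 : 0 < D := by have := sub_pos.2 hab; positivity
    have hbound : ∀ ε > 0, ‖∫ t in c..x, g t‖ ≤ D * ε := by
      intro ε hε
      have hs := h1.eventually_lt_const (u := ε) hε
      obtain ⟨N, hN1, hN2⟩ := ((hsmall ε hε).and hs).exists
      have hgi : IntervalIntegrable g volume c x := hg.mono_set hsubu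
      have hRi' : IntervalIntegrable (R N) volume c x := (hRi N).mono_set hsubu
      have hpart1 : ‖∫ t in c..x, (R N t - g t)‖ ≤ ε := by
        refine intervalIntegral.norm_integral_le_integral_norm_uIoc.trans ?_
        refine le_trans ?_ hN2.le
        rw [intervalIntegral.integral_of_le hab.le]
        refine setIntegral_mono_set
          ((intervalIntegrable_iff_integrableOn_Ioc_of_le hab.le).1 ((hRi N).sub hg).norm)
          (Eventually.of_forall fun _ => norm_nonneg _) (Eventually.of_forall ?_)
        exact Ioc_subset_Ioc (le_min hcI.1.le hx.1.le) (max_le hcI.2.le hx.2.le)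
      have hterm' : ∀ j ∈ Finset.range n,
          IntervalIntegrable (fun t => q j t * W N j t) volume c x := fun j hj =>
        ((hterm N j (Finset.mem_range.1 hj)).mono hsub').intervalIntegrable
      have hWn : IntervalIntegrable (W N n) volume c x :=
        ((hW N).continuousOn_uIcc le_rfl (ha.trans hcI.1) (ha.trans hx.1)).intervalIntegrable
      have hpart2 : ‖∫ t in c..x, R N t‖ ≤ (2 + n * (Q * (b - a))) * ε := by
        have hsplit : ∫ t in c..x, R N t = (∫ t in c..x, W N n t) +
            ∑ j ∈ Finset.range n, ∫ t in c..x, q j t * W N j t := by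
          rw [← intervalIntegral.integral_finsetSum hterm', ← intervalIntegral.integral_add hWn]
          exact (continuousOn_finsetSum _ fun j hj =>
            (hterm N j (Finset.mem_range.1 hj)).mono hsub').intervalIntegrable
        -- Integration turns the uncontrolled top derivative into values of order $n-1$, which are
        -- uniformly small.
        have hftc : ∫ t in c..x, W N n t = W N (n - 1) x - W N (n - 1) c := by
          have hn1 : n - 1 + 1 = n := by omega
          refine intervalIntegral.integral_eq_sub_of_hasDerivAt (fun t ht => ?_) hWn
          have := (hW N).hasDerivAt (n - 1) (by omega) t (ha.trans (hsub ht).1)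
          rwa [hn1] at this
        have hj1 : n - 1 ∈ Finset.range n := Finset.mem_range.2 (by omega)
        have b1 : ‖∫ t in c..x, W N n t‖ ≤ 2 * ε := by
          rw [hftc]
          have := norm_sub_le (W N (n - 1) x) (W N (n - 1) c)
          have := hN1 _ hj1 x hx
          have := hN1 _ hj1 c hcI
          linarith
        have b2 : ‖∑ j ∈ Finset.range n, ∫ t in c..x, q j t * W N j t‖ ≤
            ∑ j ∈ Finset.range n, Q * ε * (b - a) := by
          refine norm_sum_le_of_le _ fun j hj => ?_
          have := intervalIntegral.norm_integral_le_of_norm_le_const (a := c) (b := x)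
            (C := Q * ε) (f := fun t => q j t * W N j t) fun t ht => by
              have ht' := uIoc_subset_uIcc ht
              rw [norm_mul]
              exact mul_le_mul (hQ j (Finset.mem_range.1 hj) t (hsub' ht'))
                (hN1 j hj t (hsub ht')).le (norm_nonneg _) hQ0
          exact this.trans (by gcongr)
        rw [Finset.sum_const, Finset.card_range, nsmul_eq_mul] at b2
        rw [hsplit]
        refine (norm_add_le _ _).trans ((add_le_add b1 b2).trans_eq ?_)
        ring
      have hdecomp : ∫ t in c..x, g t = (∫ t in c..x, R N t) - ∫ t in c..x, (R N t - g t) := by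
        rw [intervalIntegral.integral_sub hRi' hgi]; ring
      rw [hdecomp]
      refine (norm_sub_le _ _).trans ((add_le_add hpart2 hpart1).trans_eq ?_)
      rw [hD]; ring
    have : ‖∫ t in c..x, g t‖ ≤ 0 := by
      refine le_of_forall_pos_le_add fun ε hε => ?_
      have := hbound (ε / D) (by positivity)
      rwa [mul_div_cancel₀ _ hD0.ne', ← zero_add ε] at this
    exact norm_le_zero_iff.1 this
  filter_upwards [hg.ae_hasDerivAt_integral] with x hx hxI
  have hcu : c ∈ uIcc a b := by rw [uIcc_of_le hab.le]; exact Ioo_subset_Icc_self hcI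
  have hxu : x ∈ uIcc a b := by rw [uIcc_of_le hab.le]; exact Ioo_subset_Icc_self hxI
  have hd := hx hxu c hcu
  have hz : HasDerivAt (fun x => ∫ t in c..x, g t) 0 x :=
    (hasDerivAt_const x (0 : ℂ)).congr_of_eventuallyEq (by
      filter_upwards [Ioo_mem_nhds hxI.1 hxI.2] with y hy using hprim y hy)
  exact hd.unique hz

/-- Elliptic operators are closed in `L¹`, locally. -/
theorem IsElliptic.exists_interval_ae_eq_zero {n : ℕ} {a : ℕ → ℝ → ℂ} (hP : IsElliptic n a)
    {c d x₀ : ℝ} (hc : 0 ≤ c) (hcx : c < x₀) (hxd : x₀ < d) :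
    ∃ α β, c < α ∧ α < x₀ ∧ x₀ < β ∧ β < d ∧
      ∀ (W : ℕ → ℕ → ℝ → ℂ) (g : ℝ → ℂ), (∀ N, IsJet n (W N)) →
        IntervalIntegrable g volume α β →
        Tendsto (fun N => ∫ x in α..β, ‖W N 0 x‖) atTop (𝓝 0) →
        Tendsto (fun N => ∫ x in α..β,
          ‖∑ i ∈ Finset.range (n + 1), a i x * W N i x - g x‖) atTop (𝓝 0) →
        ∀ᵐ x, x ∈ Ioo α β → g x = 0 := by
  set c' := (c + x₀) / 2 with hc'
  set d' := (x₀ + d) / 2 with hd'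
  have hc'0 : 0 < c' := by rw [hc']; linarith
  have hIcc : Icc c' d' ⊆ Ioi 0 := fun x hx => hc'0.trans_le hx.1
  have hqc : ∀ j ≤ n, ContinuousOn (fun x => a j x / a n x) (Icc c' d') := fun j hj =>
    ((hP.continuousOn_coeff j hj).mono hIcc).div ((hP.continuousOn_coeff n le_rfl).mono hIcc)
      fun x hx => hP.leading_ne_zero x (hIcc hx)
  have hB : ∀ j, ∃ B : ℝ, 0 ≤ B ∧ (j ≤ n → ∀ x ∈ Icc c' d', ‖a j x / a n x‖ ≤ B) := by
    intro j
    by_cases hj : j ≤ n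
    · obtain ⟨B, hB⟩ := isCompact_Icc.exists_bound_of_continuousOn (hqc j hj)
      exact ⟨max B 0, le_max_right _ _, fun _ x hx => (hB x hx).trans (le_max_left _ _)⟩
    · exact ⟨0, le_rfl, fun h => absurd h hj⟩
  choose B hB0 hB using hB
  set Q := ∑ j ∈ Finset.range n, B j with hQd
  have hQ0 : 0 ≤ Q := Finset.sum_nonneg fun j _ => hB0 j
  have hQ : ∀ j < n, ∀ x ∈ Icc c' d', ‖a j x / a n x‖ ≤ Q := fun j hj x hx =>
    (hB j hj.le x hx).trans
      (Finset.single_le_sum (f := B) (fun i _ => hB0 i) (Finset.mem_range.2 hj))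
  obtain ⟨D, hD⟩ := isCompact_Icc.exists_bound_of_continuousOn
    (((hP.continuousOn_coeff n le_rfl).mono hIcc).inv₀
      fun x hx => hP.leading_ne_zero x (hIcc hx))
  -- The interval of length $2\varepsilon$ stays in $[c',d']$, and the last bound gives both
  -- $2\varepsilon\le1$ and $nQ\cdot2\varepsilon\le1/2$.
  set ε := min (min (x₀ - c') (d' - x₀)) (1 / (4 * (n * Q + 1))) with hεd
  have hnQ : 0 ≤ (n : ℝ) * Q := by positivity
  have hε : 0 < ε := lt_min (lt_min (by rw [hc']; linarith) (by rw [hd']; linarith)) (by positivity)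
  have hε1 : ε ≤ x₀ - c' := (min_le_left _ _).trans (min_le_left _ _)
  have hε2 : ε ≤ d' - x₀ := (min_le_left _ _).trans (min_le_right _ _)
  have hε3 : ε * (4 * (n * Q + 1)) ≤ 1 := (le_div_iff₀ (by positivity)).1 (min_le_right _ _)
  have hsub : Icc (x₀ - ε) (x₀ + ε) ⊆ Icc c' d' := Icc_subset_Icc (by linarith) (by linarith)
  have hαβ : x₀ - ε < x₀ + ε := by linarith
  refine ⟨x₀ - ε, x₀ + ε, by rw [hc'] at hε1; linarith, by linarith, by linarith,
    by rw [hd'] at hε2; linarith, fun W g hW hg h0 h1 => ?_⟩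
  have hinv : ContinuousOn (fun x => (a n x)⁻¹) (uIcc (x₀ - ε) (x₀ + ε)) := by
    rw [uIcc_of_le hαβ.le]
    exact ((hP.continuousOn_coeff n le_rfl).mono (hsub.trans hIcc)).inv₀
      fun x hx => hP.leading_ne_zero x (hIcc (hsub hx))
  have hα0 : 0 < x₀ - ε := by linarith
  have key := ae_eq_zero_of_tendsto_monic hP.order_pos (Q := Q) hα0 hαβ
    (by nlinarith) (fun j x => a j x / a n x) (fun j hj => (hqc j hj.le).mono hsub)
    (fun j hj x hx => hQ j hj x (hsub hx)) (by nlinarith) hW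
    (g := fun x => (a n x)⁻¹ * g x) (hg.continuousOn_mul hinv) h0 ?_
  · filter_upwards [key] with x hx hxI
    exact (mul_eq_zero.1 (hx hxI)).resolve_left
      (inv_ne_zero (hP.leading_ne_zero x (hα0.trans hxI.1)))
  · refine squeeze_zero (fun N => intervalIntegral.integral_nonneg hαβ.le fun _ _ => norm_nonneg _)
      (fun N => ?_) (by simpa using h1.const_mul D)
    rw [← intervalIntegral.integral_const_mul]
    have hPc : ContinuousOn (fun x => ∑ i ∈ Finset.range (n + 1), a i x * W N i x)
        (uIcc (x₀ - ε) (x₀ + ε)) := by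
      refine continuousOn_finsetSum _ fun i hi => ?_
      have hi' : i ≤ n := Nat.lt_succ_iff.1 (Finset.mem_range.1 hi)
      refine ContinuousOn.mul ?_ ((hW N).continuousOn_uIcc hi' hα0 (hα0.trans hαβ))
      rw [uIcc_of_le hαβ.le]
      exact (hP.continuousOn_coeff i hi').mono (hsub.trans hIcc)
    have heq : ∀ x ∈ Icc (x₀ - ε) (x₀ + ε),
        W N n x + ∑ j ∈ Finset.range n, a j x / a n x * W N j x - (a n x)⁻¹ * g x =
        (a n x)⁻¹ * (∑ i ∈ Finset.range (n + 1), a i x * W N i x - g x) := by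
      intro x hx
      have hne := hP.leading_ne_zero x (hIcc (hsub hx))
      rw [Finset.sum_range_succ, mul_sub, mul_add, Finset.mul_sum, ← mul_assoc,
        inv_mul_cancel₀ hne, one_mul, add_comm (W N n x)]
      congr 2
      refine Finset.sum_congr rfl fun j _ => ?_
      rw [div_eq_mul_inv]; ring
    have hi1 := (hPc.intervalIntegrable (μ := volume)).sub hg
    have hi2 := hi1.continuousOn_mul hinv
    rw [intervalIntegral.integral_congr (g := fun x =>
      ‖(a n x)⁻¹ * (∑ i ∈ Finset.range (n + 1), a i x * W N i x - g x)‖)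
      fun x hx => by
        rw [uIcc_of_le hαβ.le] at hx
        exact congrArg norm (heq x hx)]
    refine intervalIntegral.integral_mono_on hαβ.le hi2.norm (hi1.norm.const_mul D) fun x hx => ?_
    rw [norm_mul]
    gcongr
    exact hD x (hsub hx)

/-- Unique continuation for `∑ a_i u^{(i)} = μ u`. -/
theorem IsElliptic.eq_zero_of_vanishing {n : ℕ} {a : ℕ → ℝ → ℂ} (hP : IsElliptic n a)
    {U : ℕ → ℝ → ℂ} (hU : IsJet n U) {μ : ℂ}
    (heq : ∀ x > 0, ∑ i ∈ Finset.range (n + 1), a i x * U i x = μ * U 0 x) {δ : ℝ} (hδ : 0 < δ)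
    (hz : ∀ x ∈ Ioo 0 δ, U 0 x = 0) : ∀ x > 0, U 0 x = 0 := by
  have hall : ∀ j ≤ n, ∀ x ∈ Ioo 0 δ, U j x = 0 := by
    intro j
    induction j with
    | zero => exact fun _ => hz
    | succ j ih =>
      intro hj x hx
      refine (hU.hasDerivAt j hj x hx.1).unique ?_
      exact (hasDerivAt_const x (0 : ℂ)).congr_of_eventuallyEq (by
        filter_upwards [Ioo_mem_nhds hx.1 hx.2] with y hy using ih (by omega) y hy)
  intro x hx
  by_cases hxδ : x < δ
  · exact hz x ⟨hx, hxδ⟩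
  push Not at hxδ
  have hIcc : Icc (δ / 2) x ⊆ Ioi 0 := fun y hy => (half_pos hδ).trans_le hy.1
  have hcont : ContinuousOn (fun y => ‖μ / a n y‖ + ∑ j ∈ Finset.range n, ‖a j y / a n y‖)
      (Icc (δ / 2) x) := by
    have han := (hP.continuousOn_coeff n le_rfl).mono hIcc
    have hne : ∀ y ∈ Icc (δ / 2) x, a n y ≠ 0 := fun y hy => hP.leading_ne_zero y (hIcc hy)
    refine (continuousOn_const.div han hne).norm.add (continuousOn_finsetSum _ fun j hj => ?_)
    exact (((hP.continuousOn_coeff j (Finset.mem_range.1 hj).le).mono hIcc).div han hne).norm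
  obtain ⟨K, hK⟩ := isCompact_Icc.exists_bound_of_continuousOn hcont
  -- The equation as a first-order system with zero data at $\delta/2$; Grönwall's inequality gives
  -- $y=0$.
  let y : ℝ → (Fin n → ℂ) := fun t j => U j t
  have hy' : ∀ t > 0, HasDerivAt y (fun j : Fin n => U (j + 1) t) t := fun t ht =>
    hasDerivAt_pi.2 fun j => hU.hasDerivAt j j.2 t ht
  have hcomp : ∀ t, ∀ j < n, ‖U j t‖ ≤ ‖y t‖ := fun t j hj => norm_le_pi_norm (y t) ⟨j, hj⟩
  have hle := norm_le_gronwallBound_of_norm_deriv_right_le (f := y)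
    (f' := fun t => fun j : Fin n => U (j + 1) t) (δ := 0) (K := max 1 K) (ε := 0)
    (a := δ / 2) (b := x)
    (fun t ht => (hy' t (hIcc ht)).continuousAt.continuousWithinAt)
    (fun t ht => (hy' t (hIcc (Ico_subset_Icc_self ht))).hasDerivWithinAt) ?_ ?_ x
    ⟨by linarith, le_rfl⟩
  · rw [gronwallBound_ε0_δ0] at hle
    exact norm_le_zero_iff.1 ((hcomp x 0 hP.order_pos).trans hle)
  · refine (pi_norm_le_iff_of_nonneg le_rfl).2 fun j => ?_
    rw [norm_le_zero_iff]
    exact hall j j.2.le _ ⟨by linarith, by linarith⟩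
  · intro t ht
    have ht0 : 0 < t := hIcc (Ico_subset_Icc_self ht)
    rw [add_zero]
    refine (pi_norm_le_iff_of_nonneg (by positivity)).2 fun j => ?_
    by_cases hj : (j : ℕ) + 1 < n
    · calc ‖U (j + 1) t‖ ≤ 1 * ‖y t‖ := by rw [one_mul]; exact hcomp t _ hj
        _ ≤ _ := by gcongr; exact le_max_left _ _
    · have hjn : (j : ℕ) + 1 = n := by have := j.2; omega
      have hne := hP.leading_ne_zero t ht0
      have htop : U n t = μ / a n t * U 0 t - ∑ j ∈ Finset.range n, a j t / a n t * U j t := by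
        have h := heq t ht0
        rw [Finset.sum_range_succ] at h
        have h2 : ∑ j ∈ Finset.range n, a j t / a n t * U j t =
            (∑ j ∈ Finset.range n, a j t * U j t) / a n t := by
          rw [Finset.sum_div]
          exact Finset.sum_congr rfl fun j _ => by ring
        rw [h2]
        field_simp
        linear_combination h
      rw [hjn]
      calc ‖U n t‖ ≤ ‖μ / a n t‖ * ‖y t‖ + ∑ j ∈ Finset.range n, ‖a j t / a n t‖ * ‖y t‖ := by
            rw [htop]
            refine (norm_sub_le _ _).trans (add_le_add ?_ (norm_sum_le_of_le _ fun j hj => ?_))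
            · rw [norm_mul]; gcongr; exact hcomp t 0 hP.order_pos
            · rw [norm_mul]; gcongr; exact hcomp t j (Finset.mem_range.1 hj)
        _ = (‖μ / a n t‖ + ∑ j ∈ Finset.range n, ‖a j t / a n t‖) * ‖y t‖ := by
            rw [add_mul, Finset.sum_mul]
        _ ≤ _ := by
            gcongr
            exact ((Real.le_norm_self _).trans (hK t (Ico_subset_Icc_self ht))).trans
              (le_max_right _ _)

/-! ### The weighted space -/

section Weight

variable {w : ℝ → ℝ}

theorem ae_weightMeasure_iff (hw_meas : AEMeasurable w (volume.restrict (Ioi (0 : ℝ))))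
    (hw_pos : ∀ r > 0, 0 < w r) {p : ℝ → Prop} :
    (∀ᵐ r ∂weightMeasure w, p r) ↔ ∀ᵐ r ∂volume.restrict (Ioi (0 : ℝ)), p r := by
  rw [weightMeasure, ae_withDensity_iff' hw_meas.ennreal_ofReal]
  refine eventually_congr ?_
  filter_upwards [ae_restrict_mem measurableSet_Ioi] with r hr
  simp [hw_pos r hr]

theorem restrict_absolutelyContinuous_weightMeasure
    (hw_meas : AEMeasurable w (volume.restrict (Ioi (0 : ℝ)))) (hw_pos : ∀ r > 0, 0 < w r) :
    volume.restrict (Ioi (0 : ℝ)) ≪ weightMeasure w := by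
  refine withDensity_absolutelyContinuous' hw_meas.ennreal_ofReal ?_
  filter_upwards [ae_restrict_mem measurableSet_Ioi] with r hr
  simp [hw_pos r hr]

/-- `L²(w dr)` embeds into `L¹` of every compact interval of `(0, ∞)`. -/
theorem exists_integral_norm_le (hw_meas : AEMeasurable w (volume.restrict (Ioi (0 : ℝ))))
    (hw_pos : ∀ r > 0, 0 < w r)
    (hw_inv : LocallyIntegrableOn (fun r => (w r)⁻¹) (Ioi (0 : ℝ)) volume)
    {α β : ℝ} (hα : 0 < α) (hαβ : α < β) :
    ∃ K : ℝ, ∀ h : ℝ → ℂ, MemLp h 2 (weightMeasure w) → IntervalIntegrable h volume α β ∧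
      ∫ r in α..β, ‖h r‖ ≤ K * (eLpNorm h 2 (weightMeasure w)).toReal := by
  have hsub : Ioc α β ⊆ Ioi 0 := fun x hx => hα.trans hx.1
  have hinv : IntegrableOn (fun r => (w r)⁻¹) (Ioc α β) :=
    (hw_inv.integrableOn_compact_subset (Icc_subset_Ioi_iff hαβ.le |>.2 hα) isCompact_Icc).mono_set
      Ioc_subset_Icc_self
  have hmeas : AEMeasurable w (volume.restrict (Ioc α β)) :=
    hw_meas.mono_measure (Measure.restrict_mono hsub le_rfl)
  -- Cauchy–Schwarz for $|h|=(|h|w^{1/2})\,w^{-1/2}$; here $D^2=\int_\alpha^\beta 1/w$, finite by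
  -- local integrability.
  set D := (∫⁻ r in Ioc α β, (ENNReal.ofReal (w r) ^ (-(1 / 2) : ℝ)) ^ (2 : ℝ)) ^ ((1 : ℝ) / 2)
    with hD
  have hDtop : D ≠ ⊤ := by
    refine ENNReal.rpow_ne_top_of_nonneg (by norm_num) ?_
    have h1 : ∫⁻ r in Ioc α β, (ENNReal.ofReal (w r) ^ (-(1 / 2) : ℝ)) ^ (2 : ℝ) =
        ∫⁻ r in Ioc α β, ‖(w r)⁻¹‖ₑ := by
      refine setLIntegral_congr_fun measurableSet_Ioc fun r hr => ?_
      have hr0 := hw_pos r (hsub hr)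
      rw [← ENNReal.rpow_mul, Real.enorm_of_nonneg (inv_nonneg.2 hr0.le),
        ENNReal.ofReal_inv_of_pos hr0, ← ENNReal.rpow_neg_one]
      norm_num
    rw [h1]
    exact hinv.2.ne
  refine ⟨D.toReal, fun h hh => ?_⟩
  have hhm : AEStronglyMeasurable h (volume.restrict (Ioc α β)) :=
    (hh.1.mono_ac (restrict_absolutelyContinuous_weightMeasure hw_meas hw_pos)).mono_measure
      (Measure.restrict_mono hsub le_rfl)
  have hle : ∫⁻ r in Ioc α β, ‖h r‖ₑ ≤ D * eLpNorm h 2 (weightMeasure w) := by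
    have hold := ENNReal.lintegral_mul_le_Lp_mul_Lq (volume.restrict (Ioc α β))
      Real.HolderConjugate.two_two
      (f := fun r => ‖h r‖ₑ * ENNReal.ofReal (w r) ^ ((1 : ℝ) / 2))
      (g := fun r => ENNReal.ofReal (w r) ^ (-(1 / 2) : ℝ))
      (hhm.enorm.mul (hmeas.ennreal_ofReal.pow_const _)) (hmeas.ennreal_ofReal.pow_const _)
    have e1 : ∫⁻ r in Ioc α β, ((fun r => ‖h r‖ₑ * ENNReal.ofReal (w r) ^ ((1 : ℝ) / 2)) *
        fun r => ENNReal.ofReal (w r) ^ (-(1 / 2) : ℝ)) r = ∫⁻ r in Ioc α β, ‖h r‖ₑ := by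
      refine setLIntegral_congr_fun measurableSet_Ioc fun r hr => ?_
      have hr0 := hw_pos r (hsub hr)
      simp only [Pi.mul_apply]
      rw [mul_assoc, ← ENNReal.rpow_add _ _ (by simpa using hr0) ENNReal.ofReal_ne_top]
      norm_num
    have e2 : ∫⁻ r in Ioc α β, (‖h r‖ₑ * ENNReal.ofReal (w r) ^ ((1 : ℝ) / 2)) ^ (2 : ℝ) ≤
        ∫⁻ r, ‖h r‖ₑ ^ (2 : ℝ) ∂weightMeasure w := by
      rw [weightMeasure, lintegral_withDensity_eq_lintegral_mul₀' hw_meas.ennreal_ofReal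
        (hh.1.enorm.pow_const _)]
      refine le_trans (le_of_eq ?_) (lintegral_mono' (Measure.restrict_mono hsub le_rfl) le_rfl)
      refine lintegral_congr fun r => ?_
      rw [ENNReal.mul_rpow_of_nonneg _ _ (by norm_num), ← ENNReal.rpow_mul]
      norm_num [mul_comm]
    have e3 : eLpNorm h 2 (weightMeasure w) =
        (∫⁻ r, ‖h r‖ₑ ^ (2 : ℝ) ∂weightMeasure w) ^ ((1 : ℝ) / 2) := by
      rw [eLpNorm_eq_lintegral_rpow_enorm_toReal (by norm_num) (by norm_num)]
      norm_num
    rw [e1] at hold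
    rw [e3, mul_comm]
    refine hold.trans ?_
    gcongr
  have hfin : D * eLpNorm h 2 (weightMeasure w) ≠ ⊤ := ENNReal.mul_ne_top hDtop hh.2.ne
  refine ⟨(intervalIntegrable_iff_integrableOn_Ioc_of_le hαβ.le).2
    ⟨hhm, lt_of_le_of_lt hle hfin.lt_top⟩, ?_⟩
  rw [intervalIntegral.integral_of_le hαβ.le, integral_norm_eq_lintegral_enorm hhm,
    ← ENNReal.toReal_mul]
  exact ENNReal.toReal_mono hfin hle

/-- The `L²`-closure of an elliptic operator on finite linear combinations of `C^n` functions
is a local operator. -/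
theorem ae_eq_zero_of_tendsto_eLpNorm
    (hw_meas : AEMeasurable w (volume.restrict (Ioi (0 : ℝ)))) (hw_pos : ∀ r > 0, 0 < w r)
    (hw_inv : LocallyIntegrableOn (fun r => (w r)⁻¹) (Ioi (0 : ℝ)) volume)
    {n : ℕ} {a : ℕ → ℝ → ℂ} (hP : IsElliptic n a) {W : ℕ → ℕ → ℝ → ℂ}
    (hW : ∀ N, IsJet n (W N)) {f g : ℝ → ℂ} (hg : MemLp g 2 (weightMeasure w))
    (hWf : ∀ N, MemLp (fun r => W N 0 r - f r) 2 (weightMeasure w))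
    (hPW : ∀ N, MemLp (fun r => ∑ i ∈ Finset.range (n + 1), a i r * W N i r - g r) 2
      (weightMeasure w))
    (h0 : Tendsto (fun N => eLpNorm (fun r => W N 0 r - f r) 2 (weightMeasure w)) atTop (𝓝 0))
    (h1 : Tendsto (fun N => eLpNorm (fun r => ∑ i ∈ Finset.range (n + 1), a i r * W N i r - g r) 2
      (weightMeasure w)) atTop (𝓝 0))
    {δ : ℝ} (hf : ∀ᵐ r, r ∈ Ioo 0 δ → f r = 0) : ∀ᵐ r, r ∈ Ioo 0 δ → g r = 0 := by
  have hnull : volume {r | r ∈ Ioo 0 δ ∧ g r ≠ 0} = 0 := by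
    refine measure_null_of_locally_null _ fun x₀ hx₀ => ?_
    obtain ⟨α, β, hα, hαx, hxβ, hβ, H⟩ :=
      hP.exists_interval_ae_eq_zero le_rfl hx₀.1.1 hx₀.1.2
    obtain ⟨K, hK⟩ := exists_integral_norm_le hw_meas hw_pos hw_inv hα (hαx.trans hxβ)
    have hαβ : α < β := hαx.trans hxβ
    have lim : ∀ F : ℕ → ℝ → ℂ, (∀ N, MemLp (F N) 2 (weightMeasure w)) →
        Tendsto (fun N => eLpNorm (F N) 2 (weightMeasure w)) atTop (𝓝 0) →
        Tendsto (fun N => ∫ r in α..β, ‖F N r‖) atTop (𝓝 0) := by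
      intro F hF hlim
      have h2 := (ENNReal.tendsto_toReal ENNReal.zero_ne_top).comp hlim
      refine squeeze_zero
        (fun N => intervalIntegral.integral_nonneg hαβ.le fun _ _ => norm_nonneg _)
        (fun N => (hK (F N) (hF N)).2) ?_
      simpa using h2.const_mul K
    have hzero := H W g hW (hK g hg).1 ?_ (lim _ hPW h1)
    · refine ⟨{r | r ∈ Ioo 0 δ ∧ g r ≠ 0} ∩ Ioo α β,
        inter_mem_nhdsWithin _ (Ioo_mem_nhds hαx hxβ), ?_⟩
      refine measure_mono_null ?_ (ae_iff.1 hzero)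
      rintro r ⟨⟨_, h⟩, hr⟩
      exact fun hr' => h (hr' hr)
    -- On this interval $f=0$, so the approximants themselves tend to $0$ in $L^1$.
    · refine (lim _ hWf h0).congr fun N => ?_
      refine intervalIntegral.integral_congr_ae ?_
      filter_upwards [hf] with r hr hrI
      rw [uIoc_of_le hαβ.le] at hrI
      rw [hr ⟨hα.trans hrI.1, hrI.2.trans_lt hβ⟩, sub_zero]
  refine measure_mono_null (fun r hr => ?_) hnull
  simpa [and_assoc] using hr

end Weight

/-! ### Expansions in an orthogonal basis -/

section Hilbert

/-- Cauchy–Schwarz and Bessel. It bounds the absolute moments of order $2m$ by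
$\|\varphi\|\,\|F_m\|$. -/
theorem sum_norm_inner_mul_inner_le {H : Type*} [NormedAddCommGroup H]
    [InnerProductSpace ℂ H] {v : ℕ → H} (hv : Orthonormal ℂ v) (x y : H) (s : Finset ℕ) :
    ∑ k ∈ s, ‖inner ℂ x (v k) * inner ℂ (v k) y‖ ≤ ‖x‖ * ‖y‖ := by
  have h := Finset.sum_mul_sq_le_sq_mul_sq s (fun k => ‖inner ℂ (v k) x‖)
    (fun k => ‖inner ℂ (v k) y‖)
  have h1 := hv.sum_inner_products_le (x := x) (s := s)
  have h2 := hv.sum_inner_products_le (x := y) (s := s)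
  have h3 : (∑ k ∈ s, ‖inner ℂ (v k) x‖ * ‖inner ℂ (v k) y‖) ^ 2 ≤ (‖x‖ * ‖y‖) ^ 2 := by
    rw [mul_pow]
    refine h.trans (mul_le_mul h1 h2 ?_ (by positivity))
    exact Finset.sum_nonneg fun _ _ => by positivity
  have h4 := (sq_le_sq₀ (Finset.sum_nonneg fun _ _ => by positivity) (by positivity)).1 h3
  refine le_trans (le_of_eq ?_) h4
  refine Finset.sum_congr rfl fun k _ => ?_
  rw [norm_mul, norm_inner_symm]

/-- If all iterates `F m = T ^ m F 0` of a diagonal operator with nonnegative eigenvalues are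
orthogonal to `φ` and satisfy Carleman's condition, then so is every spectral component of `F 0`. -/
theorem inner_spectral_component_eq_zero {H : Type*} [NormedAddCommGroup H]
    [InnerProductSpace ℂ H] [CompleteSpace H] (b : HilbertBasis ℕ ℂ H) {eig : ℕ → ℝ}
    (heig : ∀ k, 0 ≤ eig k) {F : ℕ → H}
    (hF : ∀ m k, inner ℂ (b k) (F (m + 1)) = (eig k : ℂ) * inner ℂ (b k) (F m))
    (hCar : ∑' m : ℕ, ENNReal.ofReal ‖F (m + 1)‖ ^ (-(1 / (2 * ((m : ℝ) + 1)))) = ⊤)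
    {φ : H} (hφ : ∀ m, inner ℂ φ (F m) = 0) {ev : ℝ} (hev : 0 ≤ ev) (S : Finset ℕ)
    (hS : ∀ k, k ∈ S ↔ eig k = ev) :
    inner ℂ φ (∑ k ∈ S, inner ℂ (b k) (F 0) • b k) = 0 := by
  have hpow : ∀ m k, inner ℂ (b k) (F m) = ((eig k ^ m : ℝ) : ℂ) * inner ℂ (b k) (F 0) := by
    intro m k
    induction m with
    | zero => simp
    | succ m ih => rw [hF, ih]; push_cast; ring
  have hsq : ∀ m k, Real.sqrt (eig k) ^ (2 * m) = eig k ^ m := fun m k => by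
    rw [pow_mul, Real.sq_sqrt (heig k)]
  have hterm : ∀ m k, Real.sqrt (eig k) ^ (2 * m) • (inner ℂ φ (b k) * inner ℂ (b k) (F 0)) =
      inner ℂ φ (b k) * inner ℂ (b k) (F m) := by
    intro m k
    rw [hsq, hpow m k, Complex.real_smul]; ring
  have hnorm : ∀ m k, Real.sqrt (eig k) ^ (2 * m) * ‖inner ℂ φ (b k) * inner ℂ (b k) (F 0)‖ =
      ‖inner ℂ φ (b k) * inner ℂ (b k) (F m)‖ := by
    intro m k
    rw [← hterm m k, norm_smul, Real.norm_eq_abs, abs_of_nonneg (by positivity)]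
  -- Square roots as nodes turn the $m$-th power of the operator into a moment of order $2m$,
  -- matching the exponent $1/(2m)$. The constant is $\|\varphi\|+1$ only to be positive.
  have main := tsum_fiber_eq_zero_of_moments (s := fun k => Real.sqrt (eig k))
    (b := fun k => inner ℂ φ (b k) * inner ℂ (b k) (F 0)) (C := ‖φ‖ + 1) (L := fun m => ‖F m‖)
    (fun k => Real.sqrt_nonneg _) ?_ ?_ (by positivity) ?_ hCar (Real.sqrt_nonneg ev)
  · rw [tsum_eq_sum (s := S)] at main
    · rw [inner_sum, ← main]
      refine Finset.sum_congr rfl fun k hk => ?_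
      rw [if_pos (by rw [(hS k).1 hk]), inner_smul_right, mul_comm]
    · intro k hk
      rw [if_neg]
      intro h
      exact hk ((hS k).2 ((Real.sqrt_inj (heig k) hev).1 h))
  · intro m
    simp_rw [hnorm]
    exact (b.summable_inner_mul_inner φ (F m)).norm
  · intro m
    simp_rw [hterm]
    rw [b.tsum_inner_mul_inner, hφ]
  · intro m
    simp_rw [hnorm]
    refine (b.summable_inner_mul_inner φ (F m)).norm.tsum_le_of_sum_le fun s => ?_
    refine (sum_norm_inner_mul_inner_le b.orthonormal φ (F m) s).trans ?_
    gcongr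
    linarith

variable {μ : Measure ℝ} {ψ : ℕ → ℝ → ℂ}

theorem inner_toLp {f g : ℝ → ℂ} (hf : MemLp f 2 μ) (hg : MemLp g 2 μ) :
    inner ℂ (hf.toLp f) (hg.toLp g) = ∫ r, conj (f r) * g r ∂μ := by
  rw [L2.inner_def]
  refine integral_congr_ae ?_
  filter_upwards [hf.coeFn_toLp, hg.coeFn_toLp] with r h1 h2
  rw [h1, h2, RCLike.inner_apply, mul_comm]

theorem IsOrthogonalBasis.exists_hilbertBasis (hψ : IsOrthogonalBasis μ ψ) :
    ∃ (b : HilbertBasis ℕ ℂ (Lp ℂ 2 μ)) (ν : ℕ → ℂ),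
      ∀ k, b k = ν k • (hψ.memLp k).toLp (ψ k) := by
  set Ψ : ℕ → Lp ℂ 2 μ := fun k => (hψ.memLp k).toLp (ψ k) with hΨ
  have hne : ∀ k, Ψ k ≠ 0 := fun k h => hψ.ne_zero k (by
    have := (hψ.memLp k).toLp_eq_toLp_iff (MemLp.zero (p := 2) (μ := μ) (ε := ℂ))
    exact this.1 (by simpa [hΨ] using h))
  have hnn : ∀ k, (‖Ψ k‖ : ℂ) ≠ 0 := fun k => by exact_mod_cast norm_ne_zero_iff.2 (hne k)
  have hon : Orthonormal ℂ fun k => ((‖Ψ k‖ : ℂ)⁻¹) • Ψ k := by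
    refine ⟨fun k => norm_smul_inv_norm (hne k), fun j k hjk => ?_⟩
    change inner ℂ (((‖Ψ j‖ : ℂ)⁻¹) • Ψ j) (((‖Ψ k‖ : ℂ)⁻¹) • Ψ k) = 0
    rw [inner_smul_left, inner_smul_right, hΨ, inner_toLp, hψ.orthogonal j k hjk]
    simp
  have hsp : ⊤ ≤ (Submodule.span ℂ (range fun k => ((‖Ψ k‖ : ℂ)⁻¹) • Ψ k)).topologicalClosure := by
    rw [← hψ.dense_span]
    refine Submodule.topologicalClosure_mono (Submodule.span_le.2 ?_)
    rintro _ ⟨k, rfl⟩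
    have : Ψ k = (‖Ψ k‖ : ℂ) • (((‖Ψ k‖ : ℂ)⁻¹) • Ψ k) := by
      rw [smul_smul, mul_inv_cancel₀ (hnn k), one_smul]
    change Ψ k ∈ _
    rw [this]
    exact Submodule.smul_mem _ _ (Submodule.subset_span ⟨k, rfl⟩)
  exact ⟨HilbertBasis.mk hon hsp, fun k => (‖Ψ k‖ : ℂ)⁻¹, fun k => by rw [HilbertBasis.coe_mk]⟩

theorem coeFn_sum_smul_toLp (hψ : ∀ k, MemLp (ψ k) 2 μ) (c : ℕ → ℂ) (s : Finset ℕ) :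
    ⇑(∑ k ∈ s, c k • (hψ k).toLp (ψ k)) =ᵐ[μ] fun r => ∑ k ∈ s, c k * ψ k r := by
  induction s using Finset.induction_on with
  | empty =>
    simp only [Finset.sum_empty]
    exact Lp.coeFn_zero ℂ 2 μ
  | insert k s hk ih =>
    rw [Finset.sum_insert hk]
    filter_upwards [Lp.coeFn_add (c k • (hψ k).toLp (ψ k)) (∑ k ∈ s, c k • (hψ k).toLp (ψ k)), ih,
      Lp.coeFn_smul (c k) ((hψ k).toLp (ψ k)), (hψ k).coeFn_toLp] with r h1 h2 h3 h4
    rw [h1, Pi.add_apply, h2, h3, Pi.smul_apply, h4, Finset.sum_insert hk, smul_eq_mul]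

/-- The expansion of a function in `L²(μ)` converges in `L²(μ)`. -/
theorem tendsto_eLpNorm_sum_sub (hψ : ∀ k, MemLp (ψ k) 2 μ) {b : HilbertBasis ℕ ℂ (Lp ℂ 2 μ)}
    {ν : ℕ → ℂ} (hb : ∀ k, b k = ν k • (hψ k).toLp (ψ k)) {f : ℝ → ℂ} (hf : MemLp f 2 μ) :
    Tendsto (fun N => eLpNorm (fun r => ∑ k ∈ Finset.range N,
      (inner ℂ (b k) (hf.toLp f) * ν k) * ψ k r - f r) 2 μ) atTop (𝓝 0) := by
  have h := (b.hasSum_repr (hf.toLp f)).tendsto_sum_nat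
  rw [tendsto_iff_edist_tendsto_0] at h
  refine h.congr fun N => ?_
  rw [Lp.edist_def]
  refine eLpNorm_congr_ae ?_
  have hsum : ∑ k ∈ Finset.range N, b.repr (hf.toLp f) k • b k =
      ∑ k ∈ Finset.range N, (inner ℂ (b k) (hf.toLp f) * ν k) • (hψ k).toLp (ψ k) :=
    Finset.sum_congr rfl fun k _ => by rw [b.repr_apply_apply, hb, smul_smul]
  rw [hsum]
  filter_upwards [coeFn_sum_smul_toLp hψ (fun k => inner ℂ (b k) (hf.toLp f) * ν k)
    (Finset.range N), hf.coeFn_toLp] with r h1 h2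
  rw [Pi.sub_apply, h1, h2]

end Hilbert

/-- Finite multiplicity makes each spectral component a finite sum of eigenfunctions, hence a $C^n$
solution of the eigenvalue equation. -/
theorem finite_eigenspace_of_growth {eig : ℕ → ℝ}
    (h : ∃ A > 0, ∃ α > 0, ∀ᶠ k : ℕ in atTop, A * (k : ℝ) ^ (α : ℝ) ≤ eig k) (ev : ℝ) :
    {k | eig k = ev}.Finite := by
  obtain ⟨A, hA, α, hα, h⟩ := h
  have ht : Tendsto (fun k : ℕ => A * (k : ℝ) ^ α) atTop atTop :=
    ((tendsto_rpow_atTop hα).comp tendsto_natCast_atTop_atTop).const_mul_atTop hA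
  have hev : ∀ᶠ k : ℕ in atTop, eig k ≠ ev := by
    filter_upwards [h, ht.eventually_gt_atTop ev] with k h1 h2
    exact (h2.trans_le h1).ne'
  rw [← Nat.cofinite_eq_atTop] at hev
  simpa using Filter.eventually_cofinite.1 hev

/-- Locality of the `L²`-realization of `P`. -/
theorem IsImage.ae_eq_zero {w : ℝ → ℝ}
    (hw_meas : AEMeasurable w (volume.restrict (Ioi (0 : ℝ)))) (hw_pos : ∀ r > 0, 0 < w r)
    (hw_inv : LocallyIntegrableOn (fun r => (w r)⁻¹) (Ioi (0 : ℝ)) volume)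
    {n : ℕ} {a : ℕ → ℝ → ℂ} (hP : IsElliptic n a) {ψ : ℕ → ℝ → ℂ}
    (hψ : ∀ k, MemLp (ψ k) 2 (weightMeasure w)) (hψ_smooth : ∀ k, ContDiffOn ℝ n (ψ k) (Ioi 0))
    {eig : ℕ → ℝ} (hψ_eig : ∀ k, ∀ r > 0, diffOp n a (ψ k) r = (eig k : ℂ) * ψ k r)
    {b : HilbertBasis ℕ ℂ (Lp ℂ 2 (weightMeasure w))}
    {ν : ℕ → ℂ} (hb : ∀ k, b k = ν k • (hψ k).toLp (ψ k)) {f g : ℝ → ℂ}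
    (hf : MemLp f 2 (weightMeasure w)) (hg : MemLp g 2 (weightMeasure w))
    (hfg : ∀ k, inner ℂ (b k) (hg.toLp g) = (eig k : ℂ) * inner ℂ (b k) (hf.toLp f)) {δ : ℝ}
    (hfz : ∀ᵐ r, r ∈ Ioo 0 δ → f r = 0) : ∀ᵐ r, r ∈ Ioo 0 δ → g r = 0 := by
  set c : ℕ → ℂ := fun k => inner ℂ (b k) (hf.toLp f) * ν k with hc
  -- $P$ maps the partial sums for $f$ to those for $g$, so the pairs converge to $(f,g)$ in the
  -- graph of $P$.
  have hPW : ∀ N : ℕ, (fun r => ∑ i ∈ Finset.range (n + 1),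
      a i r * ∑ k ∈ Finset.range N, c k * iteratedDeriv i (ψ k) r) =ᵐ[weightMeasure w]
      fun r => ∑ k ∈ Finset.range N, (inner ℂ (b k) (hg.toLp g) * ν k) * ψ k r := by
    intro N
    refine (ae_weightMeasure_iff hw_meas hw_pos).2 ?_
    filter_upwards [ae_restrict_mem measurableSet_Ioi] with r hr
    simp_rw [Finset.mul_sum]
    rw [Finset.sum_comm]
    refine Finset.sum_congr rfl fun k _ => ?_
    have h := hψ_eig k r hr
    rw [diffOp] at h
    rw [hfg k, hc]
    calc _ = inner ℂ (b k) (hf.toLp f) * ν k *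
          ∑ i ∈ Finset.range (n + 1), a i r * iteratedDeriv i (ψ k) r := by
          rw [Finset.mul_sum]
          exact Finset.sum_congr rfl fun i _ => by ring
      _ = _ := by rw [h]; ring
  have hsum : ∀ (d : ℕ → ℂ) (N : ℕ),
      MemLp (fun r => ∑ k ∈ Finset.range N, d k * ψ k r) 2 (weightMeasure w) := fun d N =>
    memLp_finsetSum _ fun k _ => (hψ k).const_mul (d k)
  have hPW' : ∀ N : ℕ, (fun r => ∑ i ∈ Finset.range (n + 1),
      a i r * (∑ k ∈ Finset.range N, c k * iteratedDeriv i (ψ k) r) - g r) =ᵐ[weightMeasure w]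
      fun r => ∑ k ∈ Finset.range N, (inner ℂ (b k) (hg.toLp g) * ν k) * ψ k r - g r := fun N =>
    (hPW N).sub (EventuallyEq.refl _ g)
  refine ae_eq_zero_of_tendsto_eLpNorm hw_meas hw_pos hw_inv hP
    (W := fun N j r => ∑ k ∈ Finset.range N, c k * iteratedDeriv j (ψ k) r) (f := f)
    (fun N => IsJet.sum_mul _ c fun k _ => IsJet.of_contDiffOn (hψ_smooth k)) hg
    (fun N => ?_) (fun N => ?_) ?_ ?_ hfz
  · simp only [iteratedDeriv_zero]
    exact (hsum c N).sub hf
  · exact ((hsum _ N).sub hg).ae_eq (hPW' N).symm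
  · simpa only [iteratedDeriv_zero] using tendsto_eLpNorm_sum_sub hψ hb hf
  · exact (tendsto_eLpNorm_sum_sub hψ hb hg).congr fun N => (eLpNorm_congr_ae (hPW' N)).symm

end EigenExpansion

/-! ### Vanishing of all spectral components -/

open EigenExpansion

theorem mainTheorem4
    -- the weight
    (w : ℝ → ℝ) (hw_meas : AEMeasurable w (volume.restrict (Ioi (0 : ℝ))))
    (hw_pos : ∀ r > 0, 0 < w r)
    (hw_inv : LocallyIntegrableOn (fun r => (w r)⁻¹) (Ioi (0 : ℝ)) volume)
    -- the elliptic operator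
    (n : ℕ) (a : ℕ → ℝ → ℂ) (hP : EigenExpansion.IsElliptic n a)
    -- the orthogonal basis of eigenfunctions, normalized at the origin
    (ψ : ℕ → ℝ → ℂ)
    (hψ_basis : EigenExpansion.IsOrthogonalBasis (EigenExpansion.weightMeasure w) ψ)
    (hψ_smooth : ∀ k, ContDiffOn ℝ n (ψ k) (Ioi 0))
    (hψ_zero : ∀ k, Tendsto (ψ k) (𝓝[>] 0) (𝓝 1))
    (eig : ℕ → ℝ) (heig_nonneg : ∀ k, 0 ≤ eig k)
    (hψ_eig : ∀ k, ∀ r > 0, EigenExpansion.diffOp n a (ψ k) r = (eig k : ℂ) * ψ k r)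
    -- polynomial growth of the eigenvalues and of the normalizing constants
    (heig_growth : ∃ A > 0, ∃ α > 0, ∀ᶠ k : ℕ in atTop, A * (k : ℝ) ^ (α : ℝ) ≤ eig k)
    (hc_growth : ∃ C β : ℝ, ∀ᶠ k : ℕ in atTop,
      EigenExpansion.normConst (EigenExpansion.weightMeasure w) ψ k ≤ C * (k : ℝ) ^ β)
    -- `Pf m` is `P ^ m f`, which lies in `L²` for every `m`
    (f : ℝ → ℂ) (Pf : ℕ → ℝ → ℂ) (hPf_zero : Pf 0 = f)
    (hPf_succ : ∀ m, EigenExpansion.IsImage (EigenExpansion.weightMeasure w) n a ψ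
      (Pf m) (Pf (m + 1)))
    -- the Carleman condition (a term with `P ^ m f = 0` counts as `∞`)
    (hCarleman : ∑' m : ℕ, eLpNorm (Pf (m + 1)) 2 (EigenExpansion.weightMeasure w) ^
      (-(1 / (2 * ((m : ℝ) + 1)))) = ⊤)
    -- `f` vanishes near the origin
    (hf_vanish : ∃ δ > 0, ∀ᵐ r ∂volume.restrict (Ioo (0 : ℝ) δ), f r = 0) :
    ∀ᵐ r ∂volume.restrict (Ioi (0 : ℝ)), f r = 0 := by
  obtain ⟨δ, hδ, hfδ⟩ := hf_vanish
  set μ := weightMeasure w with hμ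
  have hae : ∀ {p : ℝ → Prop}, (∀ᵐ r ∂μ, p r) ↔ ∀ᵐ r ∂volume.restrict (Ioi (0 : ℝ)), p r :=
    ae_weightMeasure_iff hw_meas hw_pos
  have hmem : ∀ m, MemLp (Pf m) 2 μ := fun m => (hPf_succ m).1
  obtain ⟨b, ν, hb⟩ := hψ_basis.exists_hilbertBasis
  set F : ℕ → Lp ℂ 2 μ := fun m => (hmem m).toLp (Pf m) with hFdef
  have hF : ∀ m k, inner ℂ (b k) (F (m + 1)) = (eig k : ℂ) * inner ℂ (b k) (F m) := by
    intro m k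
    rw [hb, inner_smul_left, inner_smul_left, hFdef, inner_toLp, inner_toLp, (hPf_succ m).2.2 k]
    have : ∫ r, conj (diffOp n a (ψ k) r) * Pf m r ∂μ =
        (eig k : ℂ) * ∫ r, conj (ψ k r) * Pf m r ∂μ := by
      rw [← integral_const_mul]
      refine integral_congr_ae (hae.2 ?_)
      filter_upwards [ae_restrict_mem measurableSet_Ioi] with r hr
      rw [hψ_eig k r hr, map_mul, Complex.conj_ofReal, mul_assoc]
    rw [this]; ring
  have hCar : ∑' m : ℕ, ENNReal.ofReal ‖F (m + 1)‖ ^ (-(1 / (2 * ((m : ℝ) + 1)))) = ⊤ := by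
    rw [← hCarleman]
    refine tsum_congr fun m => ?_
    rw [hFdef, Lp.norm_toLp, ENNReal.ofReal_toReal (hmem _).2.ne]
  have hvan : ∀ m, ∀ᵐ r, r ∈ Ioo 0 δ → Pf m r = 0 := by
    intro m
    induction m with
    | zero =>
      rw [hPf_zero]
      exact (ae_restrict_iff' measurableSet_Ioo).1 hfδ
    | succ m ih =>
      exact IsImage.ae_eq_zero hw_meas hw_pos hw_inv hP hψ_basis.memLp hψ_smooth hψ_eig hb
        (hmem m) (hmem (m + 1)) (hF m) ih
  have hcoef : ∀ k₀, inner ℂ (b k₀) (F 0) = 0 := by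
    intro k₀
    set S := (finite_eigenspace_of_growth heig_growth (eig k₀)).toFinset with hSdef
    have hS : ∀ k, k ∈ S ↔ eig k = eig k₀ := fun k => by simp [hSdef]
    set c : ℕ → ℂ := fun k => inner ℂ (b k) (F 0) * ν k with hc
    set U : ℕ → ℝ → ℂ := fun j r => ∑ k ∈ S, c k * iteratedDeriv j (ψ k) r with hU
    have hjet : IsJet n U := IsJet.sum_mul _ c fun k _ => IsJet.of_contDiffOn (hψ_smooth k)
    have hU0 : U 0 = fun r => ∑ k ∈ S, c k * ψ k r := by simp [hU]
    have hUmem : MemLp (U 0) 2 μ := by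
      rw [hU0]
      exact memLp_finsetSum _ fun k _ => (hψ_basis.memLp k).const_mul (c k)
    have hG : ∑ k ∈ S, inner ℂ (b k) (F 0) • b k = hUmem.toLp (U 0) := by
      refine Lp.ext ?_
      have hsum : ∑ k ∈ S, inner ℂ (b k) (F 0) • b k =
          ∑ k ∈ S, c k • (hψ_basis.memLp k).toLp (ψ k) :=
        Finset.sum_congr rfl fun k _ => by simp only [hc, mul_smul, ← hb]
      rw [hsum]
      filter_upwards [coeFn_sum_smul_toLp hψ_basis.memLp c S, hUmem.coeFn_toLp] with r h1 h2
      rw [h1, h2, hU0]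
    -- The test vector is the spectral component cut off to $(0,\delta)$: it is orthogonal to every
    -- $P^mf$ because those vanish there.
    have hφmem : MemLp ((Ioo 0 δ).indicator (U 0)) 2 μ := hUmem.indicator measurableSet_Ioo
    have hinner := inner_spectral_component_eq_zero b heig_nonneg hF hCar
      (φ := hφmem.toLp _) (fun m => ?_) (heig_nonneg k₀) S hS
    -- The pairing of the component with its own truncation is
    -- $\int_0^\delta|U|^2w\,dr=\|\varphi\|^2$.
    · have hφ0 : hφmem.toLp _ = 0 := by
        rw [hG, inner_toLp] at hinner
        rw [← inner_self_eq_zero (𝕜 := ℂ), inner_toLp, ← hinner]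
        refine integral_congr_ae (Eventually.of_forall fun r => ?_)
        by_cases hr : r ∈ Ioo 0 δ <;> simp [hr]
      have hφae : (Ioo 0 δ).indicator (U 0) =ᵐ[μ] 0 := by
        have h1 := hφmem.coeFn_toLp
        rw [hφ0] at h1
        exact h1.symm.trans (Lp.coeFn_zero ℂ 2 μ)
      have hUae : U 0 =ᵐ[volume.restrict (Ioo 0 δ)] fun _ => 0 := by
        have h1 := ae_mono (Measure.restrict_mono (fun x hx => hx.1 : Ioo 0 δ ⊆ Ioi 0) le_rfl)
          (hae.1 hφae)
        filter_upwards [h1, ae_restrict_mem measurableSet_Ioo] with r h2 hr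
        simpa [indicator_of_mem hr] using h2
      have hUz : ∀ r ∈ Ioo 0 δ, U 0 r = 0 := Measure.eqOn_open_of_ae_eq hUae isOpen_Ioo
        ((hjet.continuousOn (Nat.zero_le n)).mono fun x hx => hx.1) continuousOn_const
      have hUall : ∀ r > 0, U 0 r = 0 := by
        refine hP.eq_zero_of_vanishing hjet (μ := (eig k₀ : ℂ)) (fun r hr => ?_) hδ hUz
        rw [hU0]
        simp only [hU, Finset.mul_sum]
        rw [Finset.sum_comm]
        refine Finset.sum_congr rfl fun k hk => ?_
        have h := hψ_eig k r hr
        rw [diffOp, (hS k).1 hk] at h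
        calc _ = c k * ∑ i ∈ Finset.range (n + 1), a i r * iteratedDeriv i (ψ k) r := by
              rw [Finset.mul_sum]
              exact Finset.sum_congr rfl fun i _ => by ring
          _ = _ := by rw [h]; ring
      have hGz : ∑ k ∈ S, inner ℂ (b k) (F 0) • b k = 0 := by
        rw [hG]
        refine (hUmem.toLp_eq_toLp_iff MemLp.zero).2 (hae.2 ?_)
        filter_upwards [ae_restrict_mem measurableSet_Ioi] with r hr using hUall r hr
      -- Orthonormality recovers the single coefficient at $k_0$ from the component, even for a
      -- multiple eigenvalue.
      have hk := b.orthonormal.inner_right_sum (fun k => inner ℂ (b k) (F 0)) ((hS k₀).2 rfl)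
      rw [← hk, hGz, inner_zero_right]
    · rw [hFdef, inner_toLp]
      refine integral_eq_zero_of_ae (hae.2 ?_)
      filter_upwards [ae_restrict_of_ae (hvan m)] with r hr
      by_cases hrI : r ∈ Ioo 0 δ
      · simp [hr hrI]
      · simp [indicator_of_notMem hrI]
  have hF0 : F 0 = 0 := by
    apply b.repr.injective
    rw [map_zero]
    ext k
    rw [b.repr_apply_apply, hcoef k]
    rfl
  have hae0 : Pf 0 =ᵐ[μ] 0 := by
    have h1 := (hmem 0).coeFn_toLp
    rw [show (hmem 0).toLp (Pf 0) = 0 from hF0] at h1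
    exact h1.symm.trans (Lp.coeFn_zero ℂ 2 μ)
  rw [hPf_zero] at hae0
  exact hae.1 hae0
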